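/- Let $\Gamma$ be a metric graph with finitely many internal edges, $N$ in number, all of the same length $\ell>0$, and finitely many halflines (external edges) attached at vertices. Let $H=-\mathrm{d}^2/\mathrm{d}x^2$ act on the edges of $\Gamma$ with standard coupling at every vertex: functions are continuous at the vertex and the sum of the outgoing derivatives there is zero. A number $k\in\mathbb{C}$ is called a resonance if there is $f\not\equiv 0$ with $-f''=k^2f$ on all edges, satisfying the coupling conditions, and equal to $c_j\,\mathrm{e}^{ikx}$ on each halfline. Let $N(R)$ be the number of resonances with $|k|\le R$, counted with multiplicity. (For $k\neq 0$ the multiplicity is the algebraic one, i.e. the dimension of the space of functions $f$ such that $(-\mathrm{d}^2/\mathrm{d}x^2-k^2)^nf=0$ on all edges for some $n$, all the functions $f,f'',f'''',\dots$ satisfy the coupling conditions, and $f$ is a polynomial times $\mathrm{e}^{ikx}$ on each halfline; $k=0$ is counted with the dimension of its space of functions $f$ as above.) The effective size of $\Gamma$ is the number $W$ such that $$N(R)=\frac{2}{\pi}WR+\mathcal{O}(1)\quad\text{as }R\to\infty .$$ A vertex is balanced if the number of internal edge ends at it equals the number of halflines attached to it. Suppose that $\Gamma$ contains four distinct balanced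 vertices $v_1,v_2,v_3,v_4$ forming a square without diagonals: $v_1$ neighbors $v_2$, $v_2$ neighbors $v_3$, $v_3$ neighbors $v_4$, $v_4$ neighbors $v_1$, while $v_1$ does not neighbor $v_3$ and $v_2$ does not neighbor $v_4$ (two vertices are neighbors if an internal edge joins them). Suppose also that there is no loop at any of $v_1,\dots,v_4$ and that no two of them are joined by more than one internal edge (in particular, this holds if $\Gamma$ has no loops and no multiple edges). Then the effective size $W$ of $\Gamma$ exists and satisfies $$W\le (N-3)\ell .$$ -/

import Mathlib

open scoped ContDiff

noncomputable section

/-- A metric graph with vertices `V`, internal edges `E` and external edges (halflines) `X`.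
The internal edge `e` is the interval `[0, length e]`, with `0` at `src e` and `length e` at
`tgt e`; the halfline `x` is `[0, ∞)`, with `0` at `root x`. Loops and multiple edges are
allowed. -/
structure MetricGraph (V E X : Type*) where
  src : E → V
  tgt : E → V
  root : X → V
  length : E → ℝ
  length_pos : ∀ e, 0 < length e

/-- Smooth complex functions of one real variable. -/
def smoothFun : Submodule ℂ (ℝ → ℂ) where
  carrier := {g | ContDiff ℝ ∞ g}
  zero_mem' := by
    show ContDiff ℝ ∞ (fun _ : ℝ => (0 : ℂ))
    exact contDiff_const
  add_mem' := fun {f g} hf hg => by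
    have hf' : ContDiff ℝ ∞ f := hf
    have hg' : ContDiff ℝ ∞ g := hg
    exact hf'.add hg'
  smul_mem' := fun c g hg => by
    have hg' : ContDiff ℝ ∞ g := hg
    exact hg'.const_smul c

theorem smoothFun_contDiff (g : smoothFun) : ContDiff ℝ ∞ g.1 := g.2

theorem smoothFun_differentiable (g : smoothFun) : Differentiable ℝ g.1 :=
  (smoothFun_contDiff g).differentiable (by simp)

/-- Differentiation `g ↦ g'` on smooth functions. -/
def smoothDeriv : smoothFun →ₗ[ℂ] smoothFun where
  toFun g := ⟨deriv g.1, (contDiff_infty_iff_deriv.mp (smoothFun_contDiff g)).2⟩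
  map_add' f g := by
    apply Subtype.ext
    funext t
    exact deriv_add (smoothFun_differentiable f t) (smoothFun_differentiable g t)
  map_smul' c g := by
    apply Subtype.ext
    funext t
    exact deriv_const_smul c (smoothFun_differentiable g t)

namespace MetricGraph

variable {V E X : Type*} (Γ : MetricGraph V E X)

/-- All internal edges have length `ℓ`. -/
def IsEquilateral (ℓ : ℝ) : Prop := ∀ e, Γ.length e = ℓ

/-- The internal edge `e` joins the vertices `v` and `w`. -/
def Joins (e : E) (v w : V) : Prop :=
  (Γ.src e = v ∧ Γ.tgt e = w) ∨ (Γ.src e = w ∧ Γ.tgt e = v)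

/-- `v` neighbors `w`: some internal edge joins them. -/
def Neighbors (v w : V) : Prop := ∃ e, Γ.Joins e v w

/-- The vertex at an edge end: `inl (e, false)` is the end `0` and `inl (e, true)` the end
`length e` of the internal edge `e`; `inr x` is the end `0` of the halfline `x`. -/
def endVertex : (E × Bool) ⊕ X → V
  | Sum.inl (e, false) => Γ.src e
  | Sum.inl (e, true) => Γ.tgt e
  | Sum.inr x => Γ.root x

/-- The vertex `v` connects as many internal as external edges (edge ends, so that a loop counts
twice). -/
def IsBalanced (v : V) : Prop :=
  Nat.card {h : E × Bool // Γ.endVertex (Sum.inl h) = v} = Nat.card {x : X // Γ.root x = v}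

/-- Functions on the graph, smooth up to the ends of every edge. All functions used below satisfy a
linear differential equation with constant coefficients on each edge, hence extend uniquely to
solutions on `ℝ`; so the component on each edge is taken to be a function on `ℝ`. -/
abbrev GraphFun (_ : MetricGraph V E X) : Type _ := E ⊕ X → smoothFun

/-- The differential expression `f ↦ -f''` on every edge. -/
def hamiltonian : Module.End ℂ Γ.GraphFun :=
  LinearMap.pi fun i => -(smoothDeriv ∘ₗ smoothDeriv ∘ₗ LinearMap.proj i)

/-- The value of `f` at an edge end. -/
def endValue : (E × Bool) ⊕ X → Γ.GraphFun → ℂ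
  | Sum.inl (e, false), f => (f (Sum.inl e)).1 0
  | Sum.inl (e, true), f => (f (Sum.inl e)).1 (Γ.length e)
  | Sum.inr x, f => (f (Sum.inr x)).1 0

/-- The outgoing derivative of `f` at an edge end (directed from the vertex into the edge). -/
def endDeriv : (E × Bool) ⊕ X → Γ.GraphFun → ℂ
  | Sum.inl (e, false), f => (smoothDeriv (f (Sum.inl e))).1 0
  | Sum.inl (e, true), f => -(smoothDeriv (f (Sum.inl e))).1 (Γ.length e)
  | Sum.inr x, f => (smoothDeriv (f (Sum.inr x))).1 0

theorem endValue_add (h : (E × Bool) ⊕ X) (f g : Γ.GraphFun) :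
    Γ.endValue h (f + g) = Γ.endValue h f + Γ.endValue h g := by
  rcases h with ⟨e, _ | _⟩ | x <;> rfl

theorem endValue_smul (h : (E × Bool) ⊕ X) (c : ℂ) (f : Γ.GraphFun) :
    Γ.endValue h (c • f) = c * Γ.endValue h f := by
  rcases h with ⟨e, _ | _⟩ | x <;> rfl

theorem endDeriv_add (h : (E × Bool) ⊕ X) (f g : Γ.GraphFun) :
    Γ.endDeriv h (f + g) = Γ.endDeriv h f + Γ.endDeriv h g := by
  rcases h with ⟨e, _ | _⟩ | x
  · simp [endDeriv]
  · simp [endDeriv]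
    ring
  · simp [endDeriv]

theorem endDeriv_smul (h : (E × Bool) ⊕ X) (c : ℂ) (f : Γ.GraphFun) :
    Γ.endDeriv h (c • f) = c * Γ.endDeriv h f := by
  rcases h with ⟨e, _ | _⟩ | x <;> simp [endDeriv]

open scoped Classical in
/-- Standard coupling at all vertices: `f` is continuous at every vertex, and the sum of its
outgoing derivatives at every vertex is zero. -/
def standardCoupling [Fintype E] [Fintype X] : Submodule ℂ Γ.GraphFun where
  carrier := {f |
    (∀ h h', Γ.endVertex h = Γ.endVertex h' → Γ.endValue h f = Γ.endValue h' f) ∧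
    ∀ v, ∑ h with Γ.endVertex h = v, Γ.endDeriv h f = 0}
  zero_mem' := by
    have h0 : ∀ h, Γ.endValue h (0 : Γ.GraphFun) = 0 := fun h => by
      simpa using Γ.endValue_smul h 0 0
    have h1 : ∀ h, Γ.endDeriv h (0 : Γ.GraphFun) = 0 := fun h => by
      simpa using Γ.endDeriv_smul h 0 0
    exact ⟨fun h h' _ => by rw [h0, h0], fun v => by simp [h1]⟩
  add_mem' := fun {f g} hf hg => by
    refine ⟨fun h h' e => ?_, fun v => ?_⟩
    · rw [endValue_add, endValue_add, hf.1 h h' e, hg.1 h h' e]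
    · simp only [endDeriv_add, Finset.sum_add_distrib, hf.2 v, hg.2 v, add_zero]
  smul_mem' := fun c f hf => by
    refine ⟨fun h h' e => ?_, fun v => ?_⟩
    · rw [endValue_smul, endValue_smul, hf.1 h h' e]
    · simp only [endDeriv_smul, ← Finset.mul_sum, hf.2 v, mul_zero]

/-- Functions equal to `c_x e^{ikt}` on every halfline `x`. -/
def outgoing (k : ℂ) : Submodule ℂ Γ.GraphFun where
  carrier := {f | ∀ x : X, ∃ c : ℂ, ∀ t : ℝ,
    (f (Sum.inr x)).1 t = c * Complex.exp (Complex.I * k * t)}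
  zero_mem' := fun _ => ⟨0, fun t => by simp⟩
  add_mem' := fun {f g} hf hg x => by
    obtain ⟨c, hc⟩ := hf x
    obtain ⟨d, hd⟩ := hg x
    exact ⟨c + d, fun t => by simp [hc t, hd t, add_mul]⟩
  smul_mem' := fun a f hf x => by
    obtain ⟨c, hc⟩ := hf x
    exact ⟨a * c, fun t => by simp [hc t, mul_assoc]⟩

/-- Functions equal to `p_x(t) e^{ikt}` on every halfline `x`, with a polynomial `p_x`. -/
def polyOutgoing (k : ℂ) : Submodule ℂ Γ.GraphFun where
  carrier := {f | ∀ x : X, ∃ p : Polynomial ℂ, ∀ t : ℝ,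
    (f (Sum.inr x)).1 t = p.eval (t : ℂ) * Complex.exp (Complex.I * k * t)}
  zero_mem' := fun _ => ⟨0, fun t => by simp⟩
  add_mem' := fun {f g} hf hg x => by
    obtain ⟨p, hp⟩ := hf x
    obtain ⟨q, hq⟩ := hg x
    exact ⟨p + q, fun t => by simp [hp t, hq t, add_mul]⟩
  smul_mem' := fun a f hf x => by
    obtain ⟨p, hp⟩ := hf x
    exact ⟨Polynomial.C a * p, fun t => by simp [hp t, mul_assoc]⟩

variable [Fintype E] [Fintype X]

/-- The generalized eigenfunctions at `k`: `-f'' = k² f` on every edge, standard coupling at every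
vertex, `c_x e^{ikt}` on every halfline. -/
def resonanceSpace (k : ℂ) : Submodule ℂ Γ.GraphFun :=
  Module.End.eigenspace Γ.hamiltonian (k ^ 2) ⊓ Γ.standardCoupling ⊓ Γ.outgoing k

/-- `k` (that is, `λ = k²`) is a resolvent resonance. -/
def IsResonance (k : ℂ) : Prop := ∃ f ∈ Γ.resonanceSpace k, f ≠ 0

/-- The root functions at `k`: `(H - k²)ⁿ f = 0` for some `n`, all of `f, H f, H² f, …` satisfy the
standard coupling, and `f` is a polynomial times `e^{ikt}` on every halfline. After complex scaling
these are the square integrable root functions of the scaled Hamiltonian for the eigenvalue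
`k²`. -/
def rootSpace (k : ℂ) : Submodule ℂ Γ.GraphFun :=
  Module.End.maxGenEigenspace Γ.hamiltonian (k ^ 2) ⊓
    (⨅ j : ℕ, Γ.standardCoupling.comap (Γ.hamiltonian ^ j)) ⊓ Γ.polyOutgoing k

open scoped Classical in
/-- The multiplicity of the resonance `k`: for `k ≠ 0` the algebraic multiplicity of `k²` as an
eigenvalue of the complex scaled Hamiltonian. The point `k = 0`, the threshold of the essential
spectrum, where complex scaling gives no algebraic multiplicity, is counted with the dimension of
its space of generalized eigenfunctions; it does not influence the asymptotics of the counting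
function. -/
def resonanceMultiplicity (k : ℂ) : ℕ :=
  if k = 0 then Module.finrank ℂ (Γ.resonanceSpace 0) else Module.finrank ℂ (Γ.rootSpace k)

/-- The resonances in the closed disc of radius `R` in the `k`-plane. -/
def resonancesIn (R : ℝ) : Set ℂ := {k | Γ.IsResonance k ∧ ‖k‖ ≤ R}

/-- The counting function `N(R)`: the number of resonances in the closed disc of radius `R` in the
`k`-plane, with multiplicities. -/
def countingFunction (R : ℝ) : ℕ := ∑ᶠ k ∈ Γ.resonancesIn R, Γ.resonanceMultiplicity k

/-- `W` is the effective size of the graph: `N(R) = (2/π) W R + O(1)` as `R → ∞`. The first two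
fields say that `N(R)` is really a finite number. -/
structure IsEffectiveSize (W : ℝ) : Prop where
  finite_resonances : ∀ R, (Γ.resonancesIn R).Finite
  finite_multiplicity : ∀ k, k ≠ 0 → FiniteDimensional ℂ (Γ.rootSpace k)
  asymptotics : (fun R : ℝ => (Γ.countingFunction R : ℝ) - 2 / Real.pi * W * R)
    =O[Filter.atTop] (fun _ : ℝ => (1 : ℝ))

end MetricGraph

end

/-! For `k ≠ 0` a solution of `-f'' = k²f` that is outgoing on the halflines is described by one
number per edge end: the amplitude of the wave leaving along the edge from that end. On an
equilateral graph a wave arrives at the opposite end multiplied by `z = e^{ikℓ}`, nothing arrives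
along a halfline, and the standard coupling turns arriving amplitudes into leaving ones by the
vertex scattering matrix (`coupling_iff_vertexScattering`). With `S` the `evolution` (propagation,
then scattering), which does not depend on `k`, `k` is a resonance exactly when `a = zSa` has a
nonzero solution, that is, when `e^{-ikℓ}` is an eigenvalue of `S`. Algebraic multiplicities agree
too (`nonempty_rootSpace_equiv`): root functions have polynomial amplitudes `g` with `g(t) = zS g(t
+ ℓ)`, and `g ↦ g(0)` maps these bijectively onto the generalized eigenspace.

Every nonzero eigenvalue `μ` of `S` gives an arithmetic progression of solutions of `e^{-ikℓ} = μ`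
with step `2π/ℓ`, hence `ℓR/π + O(1)` of them in the disc. So the effective size is `ℓ/2` times the
number of nonzero eigenvalues of `S` with multiplicity (`isEffectiveSize_of_isEquilateral`), and
this number is at most the rank of `S³`.

To bound that rank, let `J` be the reversal of directed internal edges and `s` the scattering
restricted to internal ends. Then `S³` factors through `sJs`. At a balanced vertex `s` is the mean
minus the identity, so the averaging projection `P` at the four vertices satisfies `sP = Ps = 0`,
and `sJs = s(1 - P)J(1 - P)s` (`finrank_range_evolution_pow_three`). On the space of dimension `2N`
the kernel of `(1 - P)J(1 - P)` contains the four-dimensional range of `P` on vertex functions at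
the square. It also contains `Ju` for each such vertex function `u` with `PJu = 0`, which means that
`u` is in the kernel of the adjacency matrix of the square; this kernel has dimension two. The sum
is direct, so the kernel has dimension at least `6` (`six_le_finrank_ker`), the rank is at most `2N
- 6`, and `W ≤ (N - 3)ℓ`. -/

noncomputable section

open Polynomial

/-! ### Generalized eigenvectors: from even or odd powers of an operator to all powers. -/

section InvariantSubspaces

variable {M : Type*} [AddCommGroup M] [Module ℂ M]

/-- If all `Nⁱ (N + c) x` lie in a subspace and `N` is nilpotent at `x`, then `x` lies in it. -/
theorem mem_of_forall_pow_add_smul_mem (N : Module.End ℂ M) {c : ℂ} (hc : c ≠ 0)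
    (A : Submodule ℂ M) (m : ℕ) (x : M) (hx : (N ^ m) x = 0)
    (h : ∀ i, (N ^ i) (N x + c • x) ∈ A) : x ∈ A := by
  induction m generalizing x with
  | zero => simp at hx; simp [hx]
  | succ m ih =>
    have hN : N x ∈ A := by
      refine ih (N x) (by simpa [pow_succ] using hx) fun i => ?_
      have := h (i + 1)
      simpa [pow_succ] using this
    have h0 : c • x ∈ A := by
      have := A.sub_mem (h 0) hN
      simpa using this
    exact (A.smul_mem_iff hc).1 h0

/-- A subspace invariant under `N² + 2 c N` is invariant under `N` at the vectors where `N` is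
nilpotent. -/
theorem nilpotent_apply_mem (N : Module.End ℂ M) {c : ℂ} (hc : c ≠ 0) (A : Submodule ℂ M)
    (hA : ∀ x ∈ A, N (N x) + (2 * c) • N x ∈ A) (n : ℕ) (x : M) (hx : (N ^ n) x = 0)
    (hxA : x ∈ A) : N x ∈ A := by
  induction n generalizing x with
  | zero => simp at hx; simp [hx]
  | succ n ih =>
    -- These vectors are all killed by `N ^ n`, one power less than `x` needs, so the induction
    -- hypothesis keeps them in `A` under one more application of `N`.
    have key : ∀ i, (N ^ i) (N (N x) + (2 * c) • N x) ∈ A := by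
      intro i
      induction i with
      | zero => simpa using hA x hxA
      | succ i ihi =>
        rw [pow_succ', Module.End.mul_apply]
        refine ih _ ?_ ihi
        have h1 : (N ^ n) (N x) = 0 := by simpa [pow_succ] using hx
        have h2 : ∀ j, (N ^ n) ((N ^ j) (N x)) = 0 := fun j => by
          rw [← Module.End.mul_apply, ← pow_add, add_comm, pow_add, Module.End.mul_apply, h1,
            map_zero]
        have h3 := h2 (i + 1)
        rw [pow_succ, Module.End.mul_apply] at h3
        rw [map_add, map_smul, map_add, map_smul, h2 i, h3, smul_zero, add_zero]
    exact mem_of_forall_pow_add_smul_mem N (mul_ne_zero two_ne_zero hc) A n (N x)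
      (by simpa [pow_succ] using hx) key

/-- A functional that vanishes on all `T²ʲ x` vanishes on all `Tʲ x`, if `x` is a generalized
eigenvector of `T` for a nonzero eigenvalue. -/
theorem forall_pow_eq_zero_of_even (T : Module.End ℂ M) {c : ℂ} (hc : c ≠ 0) (L : M →ₗ[ℂ] ℂ)
    (n : ℕ) (x : M) (hx : ((T - c • (1 : Module.End ℂ M)) ^ n) x = 0)
    (h : ∀ j, L ((T ^ (2 * j)) x) = 0) (j : ℕ) : L ((T ^ j) x) = 0 := by
  set N := T - c • (1 : Module.End ℂ M) with hN
  have hT : T = N + c • (1 : Module.End ℂ M) := by simp [hN]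
  -- `A` is invariant under `T²`, hence under `T² - c² = N² + 2cN`; by nilpotency it is then closed
  -- under `N`, and so under `T`, along the orbit of `x`.
  let A : Submodule ℂ M := ⨅ j : ℕ, LinearMap.ker (L ∘ₗ (T ^ (2 * j)))
  have memA : ∀ y, y ∈ A ↔ ∀ j, L ((T ^ (2 * j)) y) = 0 := fun y => by simp [A]
  have hA2 : ∀ y ∈ A, T (T y) ∈ A := fun y hy => by
    rw [memA] at hy ⊢
    intro j
    have := hy (j + 1)
    simpa [Nat.mul_add, pow_succ] using this
  have hA : ∀ y ∈ A, N (N y) + (2 * c) • N y ∈ A := fun y hy => by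
    have e : N (N y) + (2 * c) • N y = T (T y) - (c * c) • y := by
      simp only [hT, LinearMap.add_apply, LinearMap.smul_apply, Module.End.one_apply, map_add,
        map_smul]
      module
    rw [e]
    exact A.sub_mem (hA2 y hy) (A.smul_mem _ hy)
  have hcomm : Commute N T := by
    rw [hN]
    exact (Commute.refl T).sub_left ((Commute.one_left T).smul_left c)
  have key : ∀ i, (T ^ i) x ∈ A := by
    intro i
    induction i with
    | zero => simpa using (memA x).2 h
    | succ i ih =>
      rw [pow_succ', Module.End.mul_apply]
      have hn : (N ^ n) ((T ^ i) x) = 0 := by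
        rw [← Module.End.mul_apply, (hcomm.pow_pow n i).eq, Module.End.mul_apply, hx, map_zero]
      have := nilpotent_apply_mem N hc A hA n _ hn ih
      have e : T ((T ^ i) x) = N ((T ^ i) x) + c • (T ^ i) x := by
        rw [hN]
        simp
      rw [e]
      exact A.add_mem this (A.smul_mem _ ih)
  simpa using (memA _).1 (key j) 0

/-- A functional that vanishes on all `T²ʲ⁺¹ x` vanishes on all `Tʲ x`, if `x` is a generalized
eigenvector of `T` for a nonzero eigenvalue. -/
theorem forall_pow_eq_zero_of_odd (T : Module.End ℂ M) {c : ℂ} (hc : c ≠ 0) (L : M →ₗ[ℂ] ℂ)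
    (n : ℕ) (x : M) (hx : ((T - c • (1 : Module.End ℂ M)) ^ n) x = 0)
    (h : ∀ j, L ((T ^ (2 * j + 1)) x) = 0) (j : ℕ) : L ((T ^ j) x) = 0 := by
  set N := T - c • (1 : Module.End ℂ M) with hN
  have hT : T = N + c • (1 : Module.End ℂ M) := by simp [hN]
  have hcomm : Commute N T := by
    rw [hN]
    exact (Commute.refl T).sub_left ((Commute.one_left T).smul_left c)
  have hTx : (N ^ n) (T x) = 0 := by
    rw [← Module.End.mul_apply, (hcomm.pow_left n).eq, Module.End.mul_apply, hx, map_zero]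
  have h1 : ∀ j, L ((T ^ j) (T x)) = 0 :=
    forall_pow_eq_zero_of_even T hc L n (T x) hTx fun j => by
      simpa [pow_succ] using h j
  let A : Submodule ℂ M := ⨅ j : ℕ, LinearMap.ker (L ∘ₗ (T ^ j))
  have memA : ∀ y, y ∈ A ↔ ∀ j, L ((T ^ j) y) = 0 := fun y => by simp [A]
  have hAT : ∀ y ∈ A, T y ∈ A := fun y hy => by
    rw [memA] at hy ⊢
    intro j
    simpa [pow_succ] using hy (j + 1)
  have hAN : ∀ i, ∀ y ∈ A, (N ^ i) y ∈ A := by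
    intro i
    induction i with
    | zero => simp
    | succ i ih =>
      intro y hy
      rw [pow_succ, Module.End.mul_apply]
      refine ih _ ?_
      rw [hN]
      simpa using A.sub_mem (hAT y hy) (A.smul_mem c hy)
  -- The even case gives `T x ∈ A`; since `T = N + c` with `c ≠ 0` and `N` nilpotent at `x`, this
  -- can be undone.
  have hxA : x ∈ A := by
    refine mem_of_forall_pow_add_smul_mem N hc A n x hx fun i => hAN i _ ?_
    have e : N x + c • x = T x := by rw [hN]; simp
    rw [e]
    exact (memA _).2 h1
  exact (memA x).1 hxA j

end InvariantSubspaces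

/-! ### Exponential polynomials as generalized solutions on an edge. -/

section ExponentialPolynomials

/-- The smooth function `t ↦ p(t) e^{ct}`. -/
def expPoly (c : ℂ) : ℂ[X] →ₗ[ℂ] smoothFun where
  toFun p := ⟨fun t : ℝ => p.eval (t : ℂ) * Complex.exp (c * t), by
    have h1 : ContDiff ℝ ∞ (fun t : ℝ => p.eval (t : ℂ)) := by
      have : ContDiff ℂ ∞ (fun x : ℂ => p.eval x) := by
        simpa using p.contDiff_aeval (𝕜 := ℂ) (n := ∞)
      exact (this.restrict_scalars ℝ).comp Complex.ofRealCLM.contDiff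
    have h2 : ContDiff ℝ ∞ (fun t : ℝ => Complex.exp (c * t)) :=
      (contDiff_const.mul Complex.ofRealCLM.contDiff).cexp
    exact h1.mul h2⟩
  map_add' p q := by
    apply Subtype.ext
    funext t
    simp [add_mul]
  map_smul' a p := by
    apply Subtype.ext
    funext t
    simp [mul_assoc]

theorem expPoly_apply (c : ℂ) (p : ℂ[X]) (t : ℝ) :
    (expPoly c p).1 t = p.eval (t : ℂ) * Complex.exp (c * t) := rfl

/-- The operator on polynomials that corresponds to differentiation of `p(t) e^{ct}`. -/
def shiftedDerivative (c : ℂ) : Module.End ℂ ℂ[X] := derivative + c • (1 : Module.End ℂ ℂ[X])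

theorem shiftedDerivative_apply (c : ℂ) (p : ℂ[X]) :
    shiftedDerivative c p = derivative p + c • p := rfl

theorem smoothDeriv_expPoly (c : ℂ) (p : ℂ[X]) :
    smoothDeriv (expPoly c p) = expPoly c (shiftedDerivative c p) := by
  apply Subtype.ext
  funext t
  change deriv (fun t : ℝ => p.eval (t : ℂ) * Complex.exp (c * t)) t = _
  have h1 : HasDerivAt (fun t : ℝ => p.eval (t : ℂ)) (p.derivative.eval (t : ℂ)) t :=
    (p.hasDerivAt (t : ℂ)).comp_ofReal
  have h2 : HasDerivAt (fun t : ℝ => Complex.exp (c * t)) (Complex.exp (c * t) * (c * 1)) t :=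
    (((hasDerivAt_id (t : ℂ)).const_mul c).cexp).comp_ofReal
  refine (h1.mul h2).deriv.trans ?_
  rw [expPoly_apply]
  simp [shiftedDerivative_apply]
  ring

theorem eq_zero_of_forall_eval_ofReal {p : ℂ[X]} (h : ∀ t : ℝ, p.eval (t : ℂ) = 0) : p = 0 := by
  refine p.eq_zero_of_infinite_isRoot (Set.Infinite.mono ?_
    (Set.infinite_range_of_injective Complex.ofReal_injective))
  rintro _ ⟨t, rfl⟩
  exact h t

theorem expPoly_injective (c : ℂ) : Function.Injective (expPoly c) := by
  rw [injective_iff_map_eq_zero]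
  intro p hp
  refine eq_zero_of_forall_eval_ofReal fun t => ?_
  have : (expPoly c p).1 t = 0 := by rw [hp]; rfl
  rw [expPoly_apply] at this
  exact (mul_eq_zero.1 this).resolve_right (Complex.exp_ne_zero _)

theorem derivative_surjective_complex (q : ℂ[X]) : ∃ p : ℂ[X], derivative p = q := by
  induction q using Polynomial.induction_on' with
  | add p q hp hq =>
    obtain ⟨a, rfl⟩ := hp
    obtain ⟨b, rfl⟩ := hq
    exact ⟨a + b, derivative_add⟩
  | monomial n a =>
    refine ⟨monomial (n + 1) (a / (n + 1)), ?_⟩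
    have : (n : ℂ) + 1 ≠ 0 := Nat.cast_add_one_ne_zero n
    rw [derivative_monomial]
    simp [this]

theorem smoothFun_eq_exp_of_deriv {c : ℂ} {g : smoothFun} (h : smoothDeriv g = c • g) :
    ∃ a : ℂ, g = expPoly c (C a) := by
  have hg : ∀ t, HasDerivAt g.1 (c * g.1 t) t := fun t => by
    have h1 := (smoothFun_differentiable g t).hasDerivAt
    have h2 : deriv g.1 t = c * g.1 t := congrFun (congrArg Subtype.val h) t
    rwa [h2] at h1
  have h2 : ∀ t : ℝ, HasDerivAt (fun t : ℝ => Complex.exp (-c * t))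
      (Complex.exp (-c * t) * (-c * 1)) t := fun t =>
    (((hasDerivAt_id (t : ℂ)).const_mul (-c)).cexp).comp_ofReal
  have h3 : ∀ t : ℝ, HasDerivAt (fun t : ℝ => g.1 t * Complex.exp (-c * t)) 0 t := fun t => by
    have h5 := (hg t).mul (h2 t)
    have h6 : c * g.1 t * Complex.exp (-c * t) + g.1 t * (Complex.exp (-c * t) * (-c * 1)) = 0 := by
      ring
    rw [h6] at h5
    exact h5
  have h4 := is_const_of_deriv_eq_zero (fun t => (h3 t).differentiableAt) fun t => (h3 t).deriv
  refine ⟨g.1 0, Subtype.ext (funext fun t => ?_)⟩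
  have h5 := h4 t 0
  simp only [Complex.ofReal_zero, mul_zero, Complex.exp_zero, mul_one] at h5
  rw [expPoly_apply, eval_C, ← h5, mul_assoc, ← Complex.exp_add]
  simp

/-- If `(D - c)g = q e^{ct}` and `p' = q`, then `g - p e^{ct}` solves the first order equation `D u
= c u`, so it is a multiple of `e^{ct}`. -/
theorem exists_expPoly_of_pow_eq_zero (c : ℂ) (n : ℕ) (g : smoothFun)
    (h : ((smoothDeriv - c • (1 : Module.End ℂ smoothFun)) ^ n) g = 0) :
    ∃ p : ℂ[X], g = expPoly c p := by
  induction n generalizing g with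
  | zero => exact ⟨0, by simpa using h⟩
  | succ n ih =>
    rw [pow_succ, Module.End.mul_apply] at h
    obtain ⟨q, hq⟩ := ih _ h
    obtain ⟨p, rfl⟩ := derivative_surjective_complex q
    have h1 : smoothDeriv (g - expPoly c p) = c • (g - expPoly c p) := by
      have h2 : smoothDeriv g = c • g + expPoly c (derivative p) := by
        rw [← hq]
        simp
      rw [map_sub, h2, smoothDeriv_expPoly, shiftedDerivative_apply, map_add, map_smul, smul_sub]
      abel
    obtain ⟨a, ha⟩ := smoothFun_eq_exp_of_deriv h1
    exact ⟨p + C a, by rw [map_add, ← ha]; abel⟩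

theorem pow_smoothDeriv_sub_expPoly (c : ℂ) (n : ℕ) (p : ℂ[X]) :
    ((smoothDeriv - c • (1 : Module.End ℂ smoothFun)) ^ n) (expPoly c p)
      = expPoly c (derivative^[n] p) := by
  induction n generalizing p with
  | zero => simp
  | succ n ih =>
    have : (smoothDeriv - c • (1 : Module.End ℂ smoothFun)) (expPoly c p)
        = expPoly c (derivative p) := by
      simp [smoothDeriv_expPoly, shiftedDerivative_apply]
    rw [pow_succ, Module.End.mul_apply, this, ih, Function.iterate_succ_apply]

theorem expPoly_mem_maxGenEigenspace (c : ℂ) (p : ℂ[X]) :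
    expPoly c p ∈ Module.End.maxGenEigenspace smoothDeriv c := by
  rw [Module.End.mem_maxGenEigenspace]
  refine ⟨p.natDegree + 1, ?_⟩
  rw [pow_smoothDeriv_sub_expPoly, iterate_derivative_eq_zero (Nat.lt_succ_self _), map_zero]

/-- The two summands are generalized eigenvectors of differentiation for different eigenvalues,
hence independent. -/
theorem expPoly_add_eq_zero {c d : ℂ} (hcd : c ≠ d) {p q : ℂ[X]}
    (h : expPoly c p + expPoly d q = 0) : p = 0 ∧ q = 0 := by
  have hdis : Disjoint (Module.End.maxGenEigenspace (smoothDeriv) c)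
      (Module.End.maxGenEigenspace (smoothDeriv) d) :=
    Module.End.disjoint_genEigenspace _ hcd _ _
  have h1 : expPoly c p = expPoly d (-q) := by
    rw [map_neg]; exact eq_neg_of_add_eq_zero_left h
  have h2 : expPoly c p = 0 := by
    refine Submodule.disjoint_def.1 hdis _ (expPoly_mem_maxGenEigenspace c p) ?_
    rw [h1]
    exact expPoly_mem_maxGenEigenspace d _
  have h3 : expPoly d q = 0 := by simpa [h2] using h
  exact ⟨(map_eq_zero_iff _ (expPoly_injective c)).1 h2,
    (map_eq_zero_iff _ (expPoly_injective d)).1 h3⟩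

/-- Generalized solutions of the equation `-D² g = k² g` are exponential polynomials. -/
theorem exists_expPoly_add_of_pow_eq_zero {k : ℂ} (hk : k ≠ 0) (n : ℕ) (g : smoothFun)
    (h : ((-(smoothDeriv ∘ₗ smoothDeriv) - (k ^ 2) • (1 : Module.End ℂ smoothFun)) ^ n) g = 0) :
    ∃ p q : ℂ[X], g = expPoly (Complex.I * k) p + expPoly (-(Complex.I * k)) q := by
  set c := Complex.I * k with hc
  have hc0 : c ≠ 0 := mul_ne_zero Complex.I_ne_zero hk
  have hk2 : k ^ 2 = -(c * c) := by
    rw [hc]; linear_combination (k * k) * Complex.I_mul_I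
  -- Here `k ≠ 0` enters: the roots `c` and `-c` differ, so the kernel of the product splits.
  have hcop : IsCoprime ((X - C c) ^ n) ((X - C (-c)) ^ n) :=
    (isCoprime_X_sub_C_of_isUnit_sub (by
      rw [sub_neg_eq_add, ← two_mul]; exact (mul_ne_zero two_ne_zero hc0).isUnit)).pow
  have hker := sup_ker_aeval_eq_ker_aeval_mul_of_coprime (smoothDeriv : Module.End ℂ smoothFun) hcop
  have hD : ∀ d : ℂ, aeval (smoothDeriv : Module.End ℂ smoothFun) (X - C d)
      = smoothDeriv - d • (1 : Module.End ℂ smoothFun) := fun d => by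
    simp [Algebra.algebraMap_eq_smul_one]
  have hfac : -(smoothDeriv ∘ₗ smoothDeriv) - (k ^ 2) • (1 : Module.End ℂ smoothFun)
      = (-1 : ℂ) • aeval (smoothDeriv : Module.End ℂ smoothFun) ((X - C c) * (X - C (-c))) := by
    rw [map_mul, hD, hD, hk2]
    ext1 x
    simp [smul_smul]
    abel
  have hmem : g ∈ LinearMap.ker
      (aeval (smoothDeriv : Module.End ℂ smoothFun) ((X - C c) ^ n * (X - C (-c)) ^ n)) := by
    rw [LinearMap.mem_ker, ← mul_pow, map_pow]
    rw [hfac, _root_.smul_pow, LinearMap.smul_apply] at h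
    exact (smul_eq_zero.1 h).resolve_left (pow_ne_zero _ (by norm_num))
  rw [← hker, Submodule.mem_sup] at hmem
  obtain ⟨a, ha, b, hb, rfl⟩ := hmem
  rw [LinearMap.mem_ker, map_pow, hD] at ha hb
  obtain ⟨p, rfl⟩ := exists_expPoly_of_pow_eq_zero c n a ha
  obtain ⟨q, rfl⟩ := exists_expPoly_of_pow_eq_zero (-c) n b hb
  exact ⟨p, q, rfl⟩

/-- A polynomial is zero if all derivatives of `p(t) e^{ct}` vanish at `0`. -/
theorem eq_zero_of_forall_shiftedDerivative_eval {c : ℂ} (p : ℂ[X])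
    (h : ∀ j, ((shiftedDerivative c ^ j) p).eval 0 = 0) : p = 0 := by
  induction hn : p.natDegree using Nat.strong_induction_on generalizing p with
  | _ n ih =>
    subst hn
    -- As `p'` is the shifted derivative of `p` minus `c p`, the hypothesis passes to `p'`, which
    -- has smaller degree.
    have h' : ∀ j, ((shiftedDerivative c ^ j) (derivative p)).eval 0 = 0 := fun j => by
      have e : derivative p = shiftedDerivative c p - c • p := by
        rw [shiftedDerivative_apply]; simp
      have h1 := h (j + 1)
      rw [pow_succ, Module.End.mul_apply] at h1
      rw [e, map_sub, map_smul, eval_sub, eval_smul, h1, h j]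
      simp
    by_cases hd : p.natDegree = 0
    · obtain ⟨a, rfl⟩ := natDegree_eq_zero.1 hd
      have := h 0
      simp at this
      simp [this]
    · have h0 := ih _ (natDegree_derivative_lt hd) _ h' rfl
      exact absurd (derivative_eq_zero.1 h0) hd

end ExponentialPolynomials

/-! ### Wave amplitudes, scattering at vertices and the evolution. -/

namespace MetricGraph

variable {V E X : Type*}

section Scattering

variable {M : Type*} [AddCommGroup M] [Module ℂ M]

/-- Given the amplitudes of the waves leaving from the edge ends, the amplitudes (up to the phase
acquired along the edge) of the waves arriving at the edge ends. No wave arrives along a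
halfline. -/
def incoming : ((E × Bool) ⊕ X → M) →ₗ[ℂ] ((E × Bool) ⊕ X → M) where
  toFun a := Sum.elim (fun h => a (Sum.inl (h.1, !h.2))) fun _ => 0
  map_add' a b := by
    funext h
    rcases h with h | x <;> simp
  map_smul' r a := by
    funext h
    rcases h with h | x <;> simp

@[simp] theorem incoming_inl (a : (E × Bool) ⊕ X → M) (h : E × Bool) :
    incoming a (Sum.inl h) = a (Sum.inl (h.1, !h.2)) := rfl

@[simp] theorem incoming_inr (a : (E × Bool) ⊕ X → M) (x : X) :
    incoming a (Sum.inr x) = 0 := rfl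

theorem incoming_map {M' : Type*} [AddCommGroup M'] [Module ℂ M'] (φ : M →ₗ[ℂ] M')
    (a : (E × Bool) ⊕ X → M) (h : (E × Bool) ⊕ X) :
    incoming (fun h' => φ (a h')) h = φ (incoming a h) := by
  rcases h with h | x <;> simp

variable [Fintype E] [Fintype X] (Γ : MetricGraph V E X)

open scoped Classical in
/-- The edge ends, internal and external, at the vertex `v`. -/
def endsAt (v : V) : Finset ((E × Bool) ⊕ X) := {h | Γ.endVertex h = v}

@[simp] theorem mem_endsAt {v : V} {h : (E × Bool) ⊕ X} :
    h ∈ Γ.endsAt v ↔ Γ.endVertex h = v := by simp [endsAt]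

/-- The scattering of waves by the standard coupling. -/
def vertexScattering : ((E × Bool) ⊕ X → M) →ₗ[ℂ] ((E × Bool) ⊕ X → M) where
  toFun b h := (2 / ((Γ.endsAt (Γ.endVertex h)).card : ℂ)) •
    ∑ h' ∈ Γ.endsAt (Γ.endVertex h), b h' - b h
  map_add' a b := by
    funext h
    simp only [Pi.add_apply, Finset.sum_add_distrib, smul_add]
    abel
  map_smul' r a := by
    funext h
    simp only [Pi.smul_apply, RingHom.id_apply, ← Finset.smul_sum, smul_sub, smul_comm r]

theorem vertexScattering_apply (b : (E × Bool) ⊕ X → M) (h : (E × Bool) ⊕ X) :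
    Γ.vertexScattering b h = (2 / ((Γ.endsAt (Γ.endVertex h)).card : ℂ)) •
      ∑ h' ∈ Γ.endsAt (Γ.endVertex h), b h' - b h := rfl

theorem vertexScattering_map {M' : Type*} [AddCommGroup M'] [Module ℂ M'] (φ : M →ₗ[ℂ] M')
    (b : (E × Bool) ⊕ X → M) (h : (E × Bool) ⊕ X) :
    Γ.vertexScattering (fun h' => φ (b h')) h = φ (Γ.vertexScattering b h) := by
  simp [vertexScattering_apply]

/-- The evolution of the wave amplitudes: propagation along the edges, then scattering at the
vertices. -/
def evolution : Module.End ℂ ((E × Bool) ⊕ X → M) := Γ.vertexScattering ∘ₗ incoming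

theorem evolution_apply (a : (E × Bool) ⊕ X → M) :
    Γ.evolution a = Γ.vertexScattering (incoming a) := rfl

theorem evolution_map {M' : Type*} [AddCommGroup M'] [Module ℂ M'] (φ : M →ₗ[ℂ] M')
    (a : (E × Bool) ⊕ X → M) :
    Γ.evolution (fun h' => φ (a h')) = fun h => φ (Γ.evolution a h) := by
  funext h
  rw [evolution_apply, evolution_apply, ← vertexScattering_map]
  exact congrFun (congrArg Γ.vertexScattering (funext fun h' => incoming_map φ a h')) h

/-- In terms of the leaving amplitudes `o` and the arriving amplitudes `i`, the standard coupling
says that `o` is obtained from `i` by scattering. -/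
theorem coupling_iff_vertexScattering (o i : (E × Bool) ⊕ X → ℂ) :
    ((∀ h h', Γ.endVertex h = Γ.endVertex h' → o h + i h = o h' + i h') ∧
      ∀ v, ∑ h ∈ Γ.endsAt v, (o h - i h) = 0) ↔ o = Γ.vertexScattering i := by
  constructor
  · rintro ⟨h1, h2⟩
    funext h
    have hD : ((Γ.endsAt (Γ.endVertex h)).card : ℂ) ≠ 0 := by
      rw [Nat.cast_ne_zero]
      exact Finset.card_ne_zero_of_mem (Γ.mem_endsAt.2 rfl)
    have h3 := h2 (Γ.endVertex h)
    have h4 : ∑ h' ∈ Γ.endsAt (Γ.endVertex h), (o h' - i h')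
        = ∑ h' ∈ Γ.endsAt (Γ.endVertex h), ((o h + i h) - 2 * i h') := by
      refine Finset.sum_congr rfl fun h' hh' => ?_
      rw [← h1 h' h (Γ.mem_endsAt.1 hh')]
      ring
    rw [h4, Finset.sum_sub_distrib, Finset.sum_const, ← Finset.mul_sum, nsmul_eq_mul] at h3
    rw [vertexScattering_apply, smul_eq_mul]
    field_simp
    linear_combination h3
  · rintro rfl
    refine ⟨fun h h' hh => ?_, fun v => ?_⟩
    · simp only [vertexScattering_apply, hh]
      ring
    · by_cases hne : (Γ.endsAt v).card = 0
      · rw [Finset.card_eq_zero.1 hne, Finset.sum_empty]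
      · have hD : ((Γ.endsAt v).card : ℂ) ≠ 0 := Nat.cast_ne_zero.2 hne
        have h4 : ∑ h ∈ Γ.endsAt v, (Γ.vertexScattering i h - i h)
            = ∑ h ∈ Γ.endsAt v, ((2 / ((Γ.endsAt v).card : ℂ)) * (∑ h' ∈ Γ.endsAt v, i h')
              - 2 * i h) := by
          refine Finset.sum_congr rfl fun h hh => ?_
          rw [vertexScattering_apply, Γ.mem_endsAt.1 hh, smul_eq_mul]
          ring
        rw [h4, Finset.sum_sub_distrib, Finset.sum_const, ← Finset.mul_sum, nsmul_eq_mul]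
        field_simp
        ring

end Scattering

/-! ### Functions on the graph built from leaving waves. -/

/-- Reflection of exponential polynomials at the midpoint of `[0, ℓ]`, on the level of the
polynomial: `p(ℓ - t) e^{c(ℓ - t)} = (reflectPoly ℓ c p)(t) e^{-ct}`. -/
def reflectPoly (ℓ : ℝ) (c : ℂ) : ℂ[X] →ₗ[ℂ] ℂ[X] :=
  Complex.exp (c * ℓ) • (aeval (C (ℓ : ℂ) - Polynomial.X : ℂ[X])).toLinearMap

theorem reflectPoly_apply (ℓ : ℝ) (c : ℂ) (p : ℂ[X]) :
    reflectPoly ℓ c p = Complex.exp (c * ℓ) • p.comp (C (ℓ : ℂ) - Polynomial.X) := rfl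

theorem reflectPoly_eval (ℓ : ℝ) (c : ℂ) (p : ℂ[X]) (t : ℂ) :
    (reflectPoly ℓ c p).eval t = Complex.exp (c * ℓ) * p.eval (ℓ - t) := by
  simp [reflectPoly_apply]

/-- Reflection reverses the direction of differentiation. The sign disappears in second derivatives,
which is why the Hamiltonian acts on all amplitudes in the same way. -/
theorem shiftedDerivative_reflectPoly (ℓ : ℝ) (c : ℂ) (p : ℂ[X]) :
    shiftedDerivative (-c) (reflectPoly ℓ c p) = -reflectPoly ℓ c (shiftedDerivative c p) := by
  simp only [shiftedDerivative_apply, reflectPoly_apply, derivative_smul, derivative_comp,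
    derivative_sub, derivative_C, derivative_X, add_comp, smul_comp, smul_add, smul_smul]
  simp only [zero_sub, neg_mul, one_mul, smul_neg, neg_smul, neg_add, mul_comm c]

theorem reflectPoly_reflectPoly (ℓ : ℝ) (c : ℂ) (p : ℂ[X]) :
    reflectPoly ℓ c (reflectPoly ℓ (-c) p) = p := by
  simp only [reflectPoly_apply, smul_comp, smul_smul, comp_assoc]
  rw [← Complex.exp_add]
  simp

variable (Γ : MetricGraph V E X)

/-- The function on the graph with the wave `p(t) e^{ct}` leaving from each edge end, where `t` is
the distance from that end. -/
def waveFun (ℓ : ℝ) (c : ℂ) : ((E × Bool) ⊕ X → ℂ[X]) →ₗ[ℂ] Γ.GraphFun :=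
  LinearMap.pi (Sum.rec
    (fun e => expPoly c ∘ₗ LinearMap.proj (Sum.inl (e, false)) +
      expPoly (-c) ∘ₗ reflectPoly ℓ c ∘ₗ LinearMap.proj (Sum.inl (e, true)))
    fun x => expPoly c ∘ₗ LinearMap.proj (Sum.inr x))

theorem waveFun_inl (ℓ : ℝ) (c : ℂ) (g : (E × Bool) ⊕ X → ℂ[X]) (e : E) :
    Γ.waveFun ℓ c g (Sum.inl e) = expPoly c (g (Sum.inl (e, false))) +
      expPoly (-c) (reflectPoly ℓ c (g (Sum.inl (e, true)))) := rfl

theorem waveFun_inr (ℓ : ℝ) (c : ℂ) (g : (E × Bool) ⊕ X → ℂ[X]) (x : X) :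
    Γ.waveFun ℓ c g (Sum.inr x) = expPoly c (g (Sum.inr x)) := rfl

theorem waveFun_injective (ℓ : ℝ) {c : ℂ} (hc : c ≠ 0) :
    Function.Injective (Γ.waveFun ℓ c) := by
  rw [injective_iff_map_eq_zero]
  intro g hg
  have hne : c ≠ -c := fun h => hc (self_eq_neg.1 h)
  have key : ∀ e, g (Sum.inl (e, false)) = 0 ∧ g (Sum.inl (e, true)) = 0 := fun e => by
    have h1 := congrFun hg (Sum.inl e)
    rw [waveFun_inl, Pi.zero_apply] at h1
    obtain ⟨h2, h3⟩ := expPoly_add_eq_zero hne h1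
    refine ⟨h2, ?_⟩
    have h4 := reflectPoly_reflectPoly ℓ (-c) (g (Sum.inl (e, true)))
    rw [neg_neg, h3, map_zero] at h4
    exact h4.symm
  funext h
  rcases h with ⟨e, _ | _⟩ | x
  · exact (key e).1
  · exact (key e).2
  · have h1 := congrFun hg (Sum.inr x)
    rw [waveFun_inr, Pi.zero_apply] at h1
    exact (map_eq_zero_iff _ (expPoly_injective c)).1 h1

/-- The operator on the polynomial amplitudes that corresponds to differentiation along the
direction of propagation. -/
def waveDerivative (E X : Type*) (c : ℂ) : Module.End ℂ ((E × Bool) ⊕ X → ℂ[X]) :=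
  (shiftedDerivative c).compLeft ((E × Bool) ⊕ X)

theorem waveDerivative_apply (c : ℂ) (g : (E × Bool) ⊕ X → ℂ[X]) (h : (E × Bool) ⊕ X) :
    waveDerivative E X c g h = shiftedDerivative c (g h) := rfl

theorem waveDerivative_pow_apply (c : ℂ) (j : ℕ) (g : (E × Bool) ⊕ X → ℂ[X])
    (h : (E × Bool) ⊕ X) : (waveDerivative E X c ^ j) g h = (shiftedDerivative c ^ j) (g h) := by
  induction j with
  | zero => simp
  | succ j ih => rw [pow_succ', pow_succ', Module.End.mul_apply, waveDerivative_apply, ih,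
      Module.End.mul_apply]

theorem hamiltonian_apply (f : Γ.GraphFun) (i : E ⊕ X) :
    Γ.hamiltonian f i = -smoothDeriv (smoothDeriv (f i)) := rfl

theorem hamiltonian_waveFun (ℓ : ℝ) (c : ℂ) (g : (E × Bool) ⊕ X → ℂ[X]) :
    Γ.hamiltonian (Γ.waveFun ℓ c g) =
      -Γ.waveFun ℓ c (waveDerivative E X c (waveDerivative E X c g)) := by
  funext i
  rw [hamiltonian_apply, Pi.neg_apply, neg_inj]
  rcases i with e | x
  · simp only [waveFun_inl, map_add, smoothDeriv_expPoly, shiftedDerivative_reflectPoly, map_neg,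
      neg_neg, waveDerivative_apply]
  · simp only [waveFun_inr, smoothDeriv_expPoly, waveDerivative_apply]

theorem hamiltonian_pow_waveFun (ℓ : ℝ) (c : ℂ) (j : ℕ) (g : (E × Bool) ⊕ X → ℂ[X]) :
    (Γ.hamiltonian ^ j) (Γ.waveFun ℓ c g) =
      (-1 : ℂ) ^ j • Γ.waveFun ℓ c ((waveDerivative E X c ^ (2 * j)) g) := by
  induction j with
  | zero => simp
  | succ j ih =>
    rw [pow_succ', Module.End.mul_apply, ih, map_smul, hamiltonian_waveFun, Nat.mul_succ,
      pow_succ' _ (2 * j + 1), pow_succ' _ (2 * j), Module.End.mul_apply, Module.End.mul_apply,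
      pow_succ, mul_smul]
    exact congrArg _ (neg_one_smul ℂ _).symm

theorem endValue_waveFun {ℓ : ℝ} (hℓ : Γ.IsEquilateral ℓ) (c : ℂ) (g : (E × Bool) ⊕ X → ℂ[X])
    (h : (E × Bool) ⊕ X) :
    Γ.endValue h (Γ.waveFun ℓ c g) = (g h).eval 0 +
      incoming (fun h' => Complex.exp (c * ℓ) * (g h').eval (ℓ : ℂ)) h := by
  rcases h with ⟨e, _ | _⟩ | x
  · simp [endValue, waveFun_inl, expPoly_apply, reflectPoly_eval]
  · have : Complex.exp (-(c * ℓ)) * Complex.exp (c * ℓ) = 1 := by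
      rw [← Complex.exp_add]; simp
    simp [endValue, waveFun_inl, expPoly_apply, reflectPoly_eval, hℓ e]
    linear_combination (eval 0 (g (Sum.inl (e, true)))) * this
  · simp [endValue, waveFun_inr, expPoly_apply]

/-- The arriving wave runs against the outgoing direction, so it enters with a minus sign, whereas
in `endValue_waveFun` it enters with a plus sign. -/
theorem endDeriv_waveFun {ℓ : ℝ} (hℓ : Γ.IsEquilateral ℓ) (c : ℂ) (g : (E × Bool) ⊕ X → ℂ[X])
    (h : (E × Bool) ⊕ X) :
    Γ.endDeriv h (Γ.waveFun ℓ c g) = (waveDerivative E X c g h).eval 0 -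
      incoming (fun h' => Complex.exp (c * ℓ) * (waveDerivative E X c g h').eval (ℓ : ℂ)) h := by
  rcases h with ⟨e, _ | _⟩ | x
  · simp [endDeriv, waveFun_inl, expPoly_apply, reflectPoly_eval, smoothDeriv_expPoly,
      shiftedDerivative_reflectPoly, waveDerivative_apply, sub_eq_add_neg]
  · have : Complex.exp (-(c * ℓ)) * Complex.exp (c * ℓ) = 1 := by
      rw [← Complex.exp_add]; simp
    simp [endDeriv, waveFun_inl, expPoly_apply, reflectPoly_eval, hℓ e, smoothDeriv_expPoly,
      shiftedDerivative_reflectPoly, waveDerivative_apply]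
    linear_combination (eval 0 (shiftedDerivative c (g (Sum.inl (e, true))))) * this
  · simp [endDeriv, waveFun_inr, expPoly_apply, smoothDeriv_expPoly, waveDerivative_apply]

end MetricGraph

/-! ### The coupling conditions as a functional equation for polynomial amplitudes. -/

theorem taylor_shiftedDerivative (c r : ℂ) (p : ℂ[X]) :
    taylor r (shiftedDerivative c p) = shiftedDerivative c (taylor r p) := by
  simp [shiftedDerivative_apply, taylor_apply, derivative_comp]

theorem taylor_shiftedDerivative_pow (c r : ℂ) (j : ℕ) (p : ℂ[X]) :
    taylor r ((shiftedDerivative c ^ j) p) = (shiftedDerivative c ^ j) (taylor r p) := by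
  induction j with
  | zero => simp
  | succ j ih => rw [pow_succ', Module.End.mul_apply, Module.End.mul_apply,
      taylor_shiftedDerivative, ih]

namespace MetricGraph

variable {V E X : Type*}

theorem exists_iterate_derivative_eq_zero {ι : Type*} [Finite ι] (g : ι → ℂ[X]) :
    ∃ n, ∀ m, n ≤ m → ∀ h, derivative^[m] (g h) = 0 := by
  obtain ⟨n, hn⟩ := (Set.finite_range fun h => (g h).natDegree).bddAbove
  exact ⟨n + 1, fun m hm h =>
    iterate_derivative_eq_zero (lt_of_le_of_lt (hn ⟨h, rfl⟩) (Nat.lt_of_succ_le hm))⟩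

theorem exists_pow_waveDerivative_sub_eq_zero [Finite E] [Finite X] (c : ℂ)
    (g : (E × Bool) ⊕ X → ℂ[X]) :
    ∃ n, ((waveDerivative E X c - c • (1 : Module.End ℂ ((E × Bool) ⊕ X → ℂ[X]))) ^ n) g = 0 := by
  have key : ∀ n h, ((waveDerivative E X c -
      c • (1 : Module.End ℂ ((E × Bool) ⊕ X → ℂ[X]))) ^ n) g h = derivative^[n] (g h) := by
    intro n h
    induction n with
    | zero => simp
    | succ n ih =>
      rw [pow_succ', Module.End.mul_apply, LinearMap.sub_apply, Pi.sub_apply, waveDerivative_apply,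
        LinearMap.smul_apply, Module.End.one_apply, Pi.smul_apply, ih, shiftedDerivative_apply,
        add_sub_cancel_right, Function.iterate_succ_apply']
  obtain ⟨n, hn⟩ := exists_iterate_derivative_eq_zero g
  exact ⟨n, funext fun h => by rw [key, hn n le_rfl]; rfl⟩

/-- The amplitudes leaving from the edge ends. -/
def leavingAmp (E X : Type*) : ((E × Bool) ⊕ X → ℂ[X]) →ₗ[ℂ] ((E × Bool) ⊕ X → ℂ) :=
  (leval 0).compLeft ((E × Bool) ⊕ X)

/-- The amplitudes arriving at the edge ends. -/
def arrivingAmp (E X : Type*) (ℓ : ℝ) (c : ℂ) :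
    ((E × Bool) ⊕ X → ℂ[X]) →ₗ[ℂ] ((E × Bool) ⊕ X → ℂ) :=
  incoming ∘ₗ (Complex.exp (c * ℓ) • leval (ℓ : ℂ)).compLeft ((E × Bool) ⊕ X)

theorem leavingAmp_apply (g : (E × Bool) ⊕ X → ℂ[X]) (h : (E × Bool) ⊕ X) :
    leavingAmp E X g h = (g h).eval 0 := rfl

theorem arrivingAmp_apply (ℓ : ℝ) (c : ℂ) (g : (E × Bool) ⊕ X → ℂ[X]) :
    arrivingAmp E X ℓ c g =
      incoming (fun h' => Complex.exp (c * ℓ) * (g h').eval (ℓ : ℂ)) := rfl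

variable (Γ : MetricGraph V E X)

theorem hamiltonian_sub_pow_apply (μ : ℂ) (n : ℕ) (f : Γ.GraphFun) (i : E ⊕ X) :
    ((Γ.hamiltonian - μ • (1 : Module.End ℂ Γ.GraphFun)) ^ n) f i =
      ((-(smoothDeriv ∘ₗ smoothDeriv) - μ • (1 : Module.End ℂ smoothFun)) ^ n) (f i) := by
  induction n with
  | zero => simp
  | succ n ih =>
    rw [pow_succ', pow_succ', Module.End.mul_apply, Module.End.mul_apply, ← ih]
    rfl

theorem waveFun_mem_polyOutgoing (ℓ : ℝ) (k : ℂ) (g : (E × Bool) ⊕ X → ℂ[X]) :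
    Γ.waveFun ℓ (Complex.I * k) g ∈ Γ.polyOutgoing k :=
  fun x => ⟨g (Sum.inr x), fun _ => rfl⟩

variable [Fintype E] [Fintype X]

theorem waveFun_mem_standardCoupling {ℓ : ℝ} (hℓ : Γ.IsEquilateral ℓ) (c : ℂ)
    (g : (E × Bool) ⊕ X → ℂ[X]) :
    Γ.waveFun ℓ c g ∈ Γ.standardCoupling ↔
      (∀ h h', Γ.endVertex h = Γ.endVertex h' →
        (leavingAmp E X + arrivingAmp E X ℓ c) g h = (leavingAmp E X + arrivingAmp E X ℓ c) g h') ∧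
      ∀ v, ∑ h ∈ Γ.endsAt v,
        (leavingAmp E X - arrivingAmp E X ℓ c) (waveDerivative E X c g) h = 0 := by
  change (_ ∧ _) ↔ _
  refine and_congr ?_ ?_
  · simp only [endValue_waveFun Γ hℓ]
    rfl
  · simp only [endDeriv_waveFun Γ hℓ]
    rfl

theorem vertexScattering_arrivingAmp (ℓ : ℝ) (c : ℂ) (g : (E × Bool) ⊕ X → ℂ[X]) :
    Γ.vertexScattering (arrivingAmp E X ℓ c g) =
      fun h => (Complex.exp (c * ℓ) • Γ.evolution (fun h' => taylor (ℓ : ℂ) (g h')) h).eval 0 := by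
  have h1 : (fun h' => Complex.exp (c * ℓ) * (g h').eval (ℓ : ℂ)) =
      fun h' => (Complex.exp (c * ℓ) • leval (0 : ℂ)) (taylor (ℓ : ℂ) (g h')) := by
    funext h'
    simp [leval_apply, taylor_eval]
  rw [arrivingAmp_apply, h1, ← evolution_apply, evolution_map]
  funext h
  simp [leval_apply]

/-- The coupling conditions on a wave function and its images under the powers of the Hamiltonian
say that its amplitudes reproduce themselves under the evolution over the length of an edge. -/
theorem waveFun_mem_iInf_comap_iff {ℓ : ℝ} (hℓ : Γ.IsEquilateral ℓ) {c : ℂ} (hc : c ≠ 0)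
    (g : (E × Bool) ⊕ X → ℂ[X]) :
    Γ.waveFun ℓ c g ∈ (⨅ j : ℕ, Γ.standardCoupling.comap (Γ.hamiltonian ^ j)) ↔
      g = Complex.exp (c * ℓ) • Γ.evolution (fun h => taylor (ℓ : ℂ) (g h)) := by
  set T := waveDerivative E X c with hT
  set S := leavingAmp E X + arrivingAmp E X ℓ c with hS
  set F := leavingAmp E X - arrivingAmp E X ℓ c with hF
  -- Powers of the Hamiltonian give only even powers of `T`: continuity is known for even powers,
  -- and the derivative condition, which contains one more `T`, for odd ones.
  have h1 : Γ.waveFun ℓ c g ∈ (⨅ j : ℕ, Γ.standardCoupling.comap (Γ.hamiltonian ^ j)) ↔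
      ∀ j, (∀ h h', Γ.endVertex h = Γ.endVertex h' →
        S ((T ^ (2 * j)) g) h = S ((T ^ (2 * j)) g) h') ∧
        ∀ v, ∑ h ∈ Γ.endsAt v, F ((T ^ (2 * j + 1)) g) h = 0 := by
    rw [Submodule.mem_iInf]
    refine forall_congr' fun j => ?_
    rw [Submodule.mem_comap, hamiltonian_pow_waveFun,
      Submodule.smul_mem_iff _ (pow_ne_zero j (by norm_num : (-1 : ℂ) ≠ 0)),
      waveFun_mem_standardCoupling Γ hℓ, pow_succ' _ (2 * j), Module.End.mul_apply]
  -- Because `g` is a generalized eigenvector of `T` for `c ≠ 0`, both conditions extend to all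
  -- powers, and they can then be combined power by power into the scattering relation.
  have h2 : (∀ j, (∀ h h', Γ.endVertex h = Γ.endVertex h' →
        S ((T ^ (2 * j)) g) h = S ((T ^ (2 * j)) g) h') ∧
        ∀ v, ∑ h ∈ Γ.endsAt v, F ((T ^ (2 * j + 1)) g) h = 0) ↔
      ∀ j, (∀ h h', Γ.endVertex h = Γ.endVertex h' → S ((T ^ j) g) h = S ((T ^ j) g) h') ∧
        ∀ v, ∑ h ∈ Γ.endsAt v, F ((T ^ j) g) h = 0 := by
    obtain ⟨n, hn⟩ := exists_pow_waveDerivative_sub_eq_zero c g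
    refine ⟨fun H j => ⟨fun h h' hh => ?_, fun v => ?_⟩, fun H j => ⟨(H _).1, (H _).2⟩⟩
    · refine sub_eq_zero.1 (forall_pow_eq_zero_of_even T hc
        (LinearMap.proj h ∘ₗ S - LinearMap.proj h' ∘ₗ S) n g hn (fun j => ?_) j)
      exact sub_eq_zero.2 ((H j).1 h h' hh)
    · have := forall_pow_eq_zero_of_odd T hc
        (∑ h ∈ Γ.endsAt v, LinearMap.proj h ∘ₗ F) n g hn (fun j => ?_) j
      · simpa using this
      · simpa using (H j).2 v
  have h3 : ∀ j, ((∀ h h', Γ.endVertex h = Γ.endVertex h' →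
        S ((T ^ j) g) h = S ((T ^ j) g) h') ∧
        ∀ v, ∑ h ∈ Γ.endsAt v, F ((T ^ j) g) h = 0) ↔
      ∀ h, ((shiftedDerivative c ^ j)
        (g h - Complex.exp (c * ℓ) • Γ.evolution (fun h => taylor (ℓ : ℂ) (g h)) h)).eval 0 = 0 := by
    intro j
    have h4 := Γ.coupling_iff_vertexScattering (leavingAmp E X ((T ^ j) g))
      (arrivingAmp E X ℓ c ((T ^ j) g))
    refine h4.trans ?_
    rw [vertexScattering_arrivingAmp, funext_iff]
    refine forall_congr' fun h => ?_
    have h5 : (fun h' => taylor (ℓ : ℂ) ((T ^ j) g h')) =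
        fun h' => (shiftedDerivative c ^ j) (taylor (ℓ : ℂ) (g h')) := by
      funext h'
      rw [hT, waveDerivative_pow_apply, taylor_shiftedDerivative_pow]
    rw [leavingAmp_apply, h5, evolution_map, hT, waveDerivative_pow_apply, map_sub, map_smul,
      eval_sub, sub_eq_zero]
  rw [h1, h2]
  simp only [h3]
  constructor
  · intro H
    funext h
    exact sub_eq_zero.1 (eq_zero_of_forall_shiftedDerivative_eval _ fun j => H j h)
  · intro H j h
    have : g h - Complex.exp (c * ℓ) • Γ.evolution (fun h => taylor (ℓ : ℂ) (g h)) h = 0 :=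
      sub_eq_zero.2 (congrFun H h)
    rw [this]
    simp

/-- The factorization `-D² - k² = -(D + c)(D - c)` reduces this to the nilpotency of `D - c`. All
large exponents are allowed so that one exponent serves all edges. -/
theorem expPoly_mem_maxGenEigenspace_hamiltonian {k c : ℂ} (hck : k ^ 2 = -(c * c)) (p : ℂ[X]) :
    ∃ n, ∀ m, n ≤ m →
      ((-(smoothDeriv ∘ₗ smoothDeriv) - k ^ 2 • (1 : Module.End ℂ smoothFun)) ^ m)
        (expPoly c p) = 0 := by
  have hfac : -(smoothDeriv ∘ₗ smoothDeriv) - (k ^ 2) • (1 : Module.End ℂ smoothFun)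
      = (-1 : ℂ) • ((smoothDeriv + c • (1 : Module.End ℂ smoothFun)) *
        (smoothDeriv - c • (1 : Module.End ℂ smoothFun))) := by
    rw [hck]
    ext1 x
    simp only [LinearMap.sub_apply, LinearMap.neg_apply, LinearMap.comp_apply,
      LinearMap.smul_apply, LinearMap.add_apply, Module.End.mul_apply, Module.End.one_apply,
      map_sub, map_smul]
    module
  have hcomm : ∀ D : Module.End ℂ smoothFun, Commute (D + c • 1) (D - c • 1) := fun D => by
    refine LinearMap.ext fun x => ?_
    simp only [LinearMap.sub_apply, LinearMap.smul_apply, LinearMap.add_apply,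
      Module.End.mul_apply, Module.End.one_apply, map_sub, map_add, map_smul]
    module
  refine ⟨p.natDegree + 1, fun m hm => ?_⟩
  rw [hfac, _root_.smul_pow, (hcomm smoothDeriv).mul_pow, LinearMap.smul_apply, Module.End.mul_apply, pow_smoothDeriv_sub_expPoly,
    iterate_derivative_eq_zero (Nat.lt_of_succ_le hm), map_zero, map_zero,
    smul_zero]

theorem waveFun_mem_maxGenEigenspace (ℓ : ℝ) {k c : ℂ} (hck : k ^ 2 = -(c * c))
    (g : (E × Bool) ⊕ X → ℂ[X]) :
    Γ.waveFun ℓ c g ∈ Module.End.maxGenEigenspace Γ.hamiltonian (k ^ 2) := by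
  have key : ∀ i : E ⊕ X, ∃ n, ∀ m, n ≤ m →
      ((-(smoothDeriv ∘ₗ smoothDeriv) - k ^ 2 • (1 : Module.End ℂ smoothFun)) ^ m)
        (Γ.waveFun ℓ c g i) = 0 := by
    rintro (e | x)
    · obtain ⟨n₁, h₁⟩ := expPoly_mem_maxGenEigenspace_hamiltonian hck (g (Sum.inl (e, false)))
      have hck' : k ^ 2 = -(-c * -c) := by rw [hck]; ring
      obtain ⟨n₂, h₂⟩ := expPoly_mem_maxGenEigenspace_hamiltonian hck'
        (reflectPoly ℓ c (g (Sum.inl (e, true))))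
      refine ⟨max n₁ n₂, fun m hm => ?_⟩
      rw [waveFun_inl, map_add, h₁ m (le_trans (le_max_left _ _) hm),
        h₂ m (le_trans (le_max_right _ _) hm), add_zero]
    · exact expPoly_mem_maxGenEigenspace_hamiltonian hck (g (Sum.inr x))
  choose n hn using key
  rw [Module.End.mem_maxGenEigenspace]
  refine ⟨Finset.univ.sup n, funext fun i => ?_⟩
  rw [hamiltonian_sub_pow_apply, hn i _ (Finset.le_sup (Finset.mem_univ i))]
  rfl

theorem sq_eq_neg_I_mul (k : ℂ) : k ^ 2 = -(Complex.I * k * (Complex.I * k)) := by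
  linear_combination (k * k) * Complex.I_mul_I

theorem waveFun_mem_rootSpace_iff {ℓ : ℝ} (hℓ : Γ.IsEquilateral ℓ) {k : ℂ} (hk : k ≠ 0)
    (g : (E × Bool) ⊕ X → ℂ[X]) :
    Γ.waveFun ℓ (Complex.I * k) g ∈ Γ.rootSpace k ↔
      g = Complex.exp (Complex.I * k * ℓ) • Γ.evolution (fun h => taylor (ℓ : ℂ) (g h)) := by
  rw [← Γ.waveFun_mem_iInf_comap_iff hℓ (mul_ne_zero Complex.I_ne_zero hk) g, rootSpace]
  exact ⟨fun h => h.1.2, fun h => ⟨⟨Γ.waveFun_mem_maxGenEigenspace ℓ (sq_eq_neg_I_mul k) g, h⟩,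
    Γ.waveFun_mem_polyOutgoing ℓ k g⟩⟩

/-- The `e^{-ikt}` part on an internal edge is, after reflection, a wave leaving the other end; on a
halfline the outgoing condition excludes such a part. -/
theorem exists_waveFun_of_mem_rootSpace (ℓ : ℝ) {k : ℂ} (hk : k ≠ 0) {f : Γ.GraphFun}
    (hf : f ∈ Γ.rootSpace k) : ∃ g, Γ.waveFun ℓ (Complex.I * k) g = f := by
  obtain ⟨⟨h1, -⟩, h2⟩ := hf
  obtain ⟨n, hn⟩ := (Module.End.mem_maxGenEigenspace _ _ _).1 h1
  have h3 : ∀ e : E, ∃ p q : ℂ[X], f (Sum.inl e) =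
      expPoly (Complex.I * k) p + expPoly (-(Complex.I * k)) q := fun e => by
    refine exists_expPoly_add_of_pow_eq_zero hk n _ ?_
    rw [← hamiltonian_sub_pow_apply, hn]
    rfl
  choose p q hpq using h3
  choose r hr using h2
  refine ⟨Sum.elim (fun h => bif h.2 then reflectPoly ℓ (-(Complex.I * k)) (q h.1) else p h.1) r,
    funext fun i => ?_⟩
  rcases i with e | x
  · rw [waveFun_inl, hpq e]
    simp only [Sum.elim_inl, cond_false, cond_true, reflectPoly_reflectPoly]
  · rw [waveFun_inr]
    exact Subtype.ext (funext fun t => (hr x t).symm)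

end MetricGraph

/-! ### Finite differences and Newton's binomial polynomials. -/

section Differences

theorem pow_taylor_sub_one_eq_zero (r : ℂ) (n : ℕ) (p : ℂ[X]) (hp : p.degree < n) :
    ((taylor r - (1 : Module.End ℂ ℂ[X])) ^ n) p = 0 := by
  induction n generalizing p with
  | zero => simpa using hp
  | succ n ih =>
    rw [pow_succ, Module.End.mul_apply]
    refine ih _ ?_
    by_cases h0 : p = 0
    · simp [h0]
    · have h1 : (taylor r p - p).degree < (taylor r p).degree :=
        degree_sub_lt_left (degree_taylor p r) (by rwa [Ne, taylor_eq_zero]) (leadingCoeff_taylor r p)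
      rw [degree_taylor] at h1
      have h2 : p.degree ≤ n := by
        rw [degree_eq_natDegree h0, Nat.cast_lt] at hp
        rw [degree_eq_natDegree h0, Nat.cast_le]
        exact Nat.le_of_lt_succ hp
      exact h1.trans_le h2

/-- The binomial coefficient of `-t/ℓ` over `j`, as a polynomial in `t`. -/
def newtonPoly (ℓ : ℂ) (j : ℕ) : ℂ[X] :=
  C ((j.factorial : ℂ)⁻¹) * (descPochhammer ℂ j).comp (C (-ℓ⁻¹) * X)

theorem newtonPoly_zero (ℓ : ℂ) : newtonPoly ℓ 0 = 1 := by simp [newtonPoly]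

theorem newtonPoly_succ_eval_zero (ℓ : ℂ) (j : ℕ) : (newtonPoly ℓ (j + 1)).eval 0 = 0 := by
  simp [newtonPoly, descPochhammer_succ_left]

/-- This is Pascal's rule in the variable `x = -t/ℓ`: shifting `t` by `ℓ` lowers `x` by one. -/
theorem newtonPoly_succ {ℓ : ℂ} (hℓ : ℓ ≠ 0) (j : ℕ) :
    newtonPoly ℓ (j + 1) = taylor ℓ (newtonPoly ℓ (j + 1)) + taylor ℓ (newtonPoly ℓ j) := by
  refine Polynomial.funext fun t => ?_
  have hs : -ℓ⁻¹ * (t + ℓ) = -ℓ⁻¹ * t - 1 := by field_simp; ring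
  have hj : (j : ℂ) + 1 ≠ 0 := Nat.cast_add_one_ne_zero j
  have hf : (j.factorial : ℂ) ≠ 0 := Nat.cast_ne_zero.2 j.factorial_ne_zero
  have h1 : (descPochhammer ℂ (j + 1)).eval (-ℓ⁻¹ * t) =
      (-ℓ⁻¹ * t) * (descPochhammer ℂ j).eval (-ℓ⁻¹ * t - 1) := by
    rw [descPochhammer_succ_left]; simp
  have h2 := descPochhammer_succ_eval j (-ℓ⁻¹ * t - 1)
  rw [eval_add, taylor_eval, taylor_eval]
  simp only [newtonPoly, eval_mul, eval_C, eval_comp, eval_X, hs, h1, h2, Nat.factorial_succ,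
    Nat.cast_mul, Nat.cast_succ]
  generalize (descPochhammer ℂ j).eval (-ℓ⁻¹ * t - 1) = y
  field_simp
  ring

end Differences

/-! ### Root functions and generalized eigenvectors of the evolution. -/

namespace MetricGraph

variable {V E X : Type*} [Fintype E] [Fintype X] (Γ : MetricGraph V E X)

/-- The evolution with the phase factor `z`, minus the identity. -/
def evolutionDefect (M : Type*) [AddCommGroup M] [Module ℂ M] (z : ℂ) :
    Module.End ℂ ((E × Bool) ⊕ X → M) := z • Γ.evolution - 1

theorem evolutionDefect_apply {M : Type*} [AddCommGroup M] [Module ℂ M] (z : ℂ)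
    (a : (E × Bool) ⊕ X → M) : Γ.evolutionDefect M z a = z • Γ.evolution a - a := rfl

theorem evolutionDefect_pow_map {M M' : Type*} [AddCommGroup M] [Module ℂ M] [AddCommGroup M']
    [Module ℂ M'] (φ : M →ₗ[ℂ] M') (z : ℂ) (n : ℕ) (a : (E × Bool) ⊕ X → M) :
    (Γ.evolutionDefect M' z ^ n) (fun h => φ (a h)) =
      fun h => φ ((Γ.evolutionDefect M z ^ n) a h) := by
  induction n with
  | zero => simp
  | succ n ih =>
    rw [pow_succ', Module.End.mul_apply, ih, evolutionDefect_apply, evolution_map]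
    funext h
    rw [pow_succ', Module.End.mul_apply, evolutionDefect_apply]
    simp

theorem mem_maxGenEigenspace_evolution_iff {z : ℂ} (hz : z ≠ 0) (a : (E × Bool) ⊕ X → ℂ) :
    a ∈ Module.End.maxGenEigenspace Γ.evolution z⁻¹ ↔
      ∃ n, (Γ.evolutionDefect ℂ z ^ n) a = 0 := by
  rw [Module.End.mem_maxGenEigenspace]
  refine exists_congr fun n => ?_
  have h : Γ.evolutionDefect ℂ z =
      z • (Γ.evolution - z⁻¹ • (1 : Module.End ℂ ((E × Bool) ⊕ X → ℂ))) := by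
    rw [smul_sub, smul_smul, mul_inv_cancel₀ hz, one_smul]
    rfl
  rw [h, _root_.smul_pow, LinearMap.smul_apply, smul_eq_zero_iff_right (pow_ne_zero n hz)]

/-- The polynomial amplitudes that reproduce themselves under the evolution over the length of an
edge, up to the phase factor `z`. -/
def periodicAmp (ℓ : ℝ) (z : ℂ) : Submodule ℂ ((E × Bool) ⊕ X → ℂ[X]) :=
  LinearMap.eqLocus LinearMap.id
    (z • (Γ.evolution ∘ₗ (taylor (ℓ : ℂ)).compLeft ((E × Bool) ⊕ X)))

theorem mem_periodicAmp {ℓ : ℝ} {z : ℂ} {g : (E × Bool) ⊕ X → ℂ[X]} :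
    g ∈ Γ.periodicAmp ℓ z ↔ g = z • Γ.evolution (fun h => taylor (ℓ : ℂ) (g h)) := Iff.rfl

theorem smul_evolution_of_mem_periodicAmp {ℓ : ℝ} {z : ℂ} {g : (E × Bool) ⊕ X → ℂ[X]}
    (hg : g ∈ Γ.periodicAmp ℓ z) : z • Γ.evolution g = fun h => taylor (-ℓ : ℂ) (g h) := by
  rw [mem_periodicAmp, evolution_map] at hg
  funext h
  have h1 : g h = z • taylor (ℓ : ℂ) (Γ.evolution g h) := congrFun hg h
  rw [h1, map_smul, taylor_taylor, neg_add_cancel, taylor_zero]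
  rfl

/-- On `g` the operator `zS - 1` acts as the difference operator of step `-ℓ` on each polynomial,
which lowers degrees and so is nilpotent. Evaluation at `0` commutes with `S`, since `S` mixes the
edge ends with scalar coefficients. -/
theorem eval_zero_mem_maxGenEigenspace {ℓ : ℝ} {z : ℂ} (hz : z ≠ 0) {g : (E × Bool) ⊕ X → ℂ[X]}
    (hg : g ∈ Γ.periodicAmp ℓ z) :
    leavingAmp E X g ∈ Module.End.maxGenEigenspace Γ.evolution z⁻¹ := by
  rw [mem_maxGenEigenspace_evolution_iff Γ hz]
  have h1 : Γ.evolutionDefect ℂ[X] z g =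
      fun h => (taylor (-ℓ : ℂ) - (1 : Module.End ℂ ℂ[X])) (g h) := by
    rw [evolutionDefect_apply, smul_evolution_of_mem_periodicAmp Γ hg]
    rfl
  have h2 : ∀ n, (Γ.evolutionDefect ℂ[X] z ^ n) g =
      fun h => ((taylor (-ℓ : ℂ) - (1 : Module.End ℂ ℂ[X])) ^ n) (g h) := by
    intro n
    induction n with
    | zero => simp
    | succ n ih =>
      rw [pow_succ, Module.End.mul_apply, h1, evolutionDefect_pow_map, ih]
      funext h
      rw [pow_succ', Module.End.mul_apply]
  refine ⟨Finset.univ.sup (fun h => (g h).natDegree) + 1, ?_⟩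
  have h3 := Γ.evolutionDefect_pow_map (leval (0 : ℂ)) z
    (Finset.univ.sup (fun h => (g h).natDegree) + 1) g
  refine h3.trans (funext fun h => ?_)
  simp only [h2]
  rw [pow_taylor_sub_one_eq_zero, map_zero]
  · rfl
  · refine lt_of_le_of_lt degree_le_natDegree ?_
    rw [Nat.cast_lt]
    exact Nat.lt_succ_of_le (Finset.le_sup (f := fun h => (g h).natDegree) (Finset.mem_univ h))

/-- The functional equation carries the vanishing from `0` to `-ℓ`, `-2ℓ`, and so on, and a
polynomial with infinitely many zeros is zero. -/
theorem eq_zero_of_mem_periodicAmp_of_eval_zero {ℓ : ℝ} (hℓ : 0 < ℓ) {z : ℂ}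
    {g : (E × Bool) ⊕ X → ℂ[X]} (hg : g ∈ Γ.periodicAmp ℓ z) (h0 : leavingAmp E X g = 0) :
    g = 0 := by
  have key : ∀ n : ℕ, ∀ h, (g h).eval (-(n * ℓ) : ℂ) = 0 := by
    intro n
    induction n with
    | zero =>
      intro h
      rw [Nat.cast_zero, zero_mul, neg_zero]
      exact congrFun h0 h
    | succ n ih =>
      intro h
      have h1 : (taylor (-ℓ : ℂ) (g h)).eval (-(n * ℓ) : ℂ) = 0 := by
        have h2 := Γ.evolution_map (leval (-(n * ℓ) : ℂ)) g
        have h3 : (fun h' => leval (-(n * ℓ) : ℂ) (g h')) = 0 := funext fun h' => ih h'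
        rw [h3, map_zero] at h2
        have h4 : (Γ.evolution g h).eval (-(n * ℓ) : ℂ) = 0 := (congrFun h2 h).symm
        rw [← congrFun (smul_evolution_of_mem_periodicAmp Γ hg) h, Pi.smul_apply, eval_smul, h4,
          smul_zero]
      rw [taylor_eval] at h1
      rw [← h1]
      push_cast
      ring_nf
  funext h
  refine (g h).eq_zero_of_infinite_isRoot (Set.Infinite.mono ?_
    (Set.infinite_range_of_injective (f := fun n : ℕ => (-(n * ℓ) : ℂ)) fun m n hmn => ?_))
  · rintro _ ⟨n, rfl⟩
    exact key n h
  · have : (ℓ : ℂ) ≠ 0 := by exact_mod_cast hℓ.ne'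
    simpa [this] using hmn

/-- The solution is `g(t) = (zS)^{-t/ℓ} a`. With `zS = 1 + N` and `N` nilpotent at `a`, the binomial
series of `(1 + N)^{-t/ℓ} a` is a finite sum of the `newtonPoly` terms. -/
theorem exists_mem_periodicAmp_eval_zero {ℓ : ℝ} (hℓ : 0 < ℓ) {z : ℂ} (hz : z ≠ 0)
    {a : (E × Bool) ⊕ X → ℂ} (ha : a ∈ Module.End.maxGenEigenspace Γ.evolution z⁻¹) :
    ∃ g ∈ Γ.periodicAmp ℓ z, leavingAmp E X g = a := by
  obtain ⟨n, hn⟩ := (mem_maxGenEigenspace_evolution_iff Γ hz a).1 ha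
  have hℓ0 : (ℓ : ℂ) ≠ 0 := by exact_mod_cast hℓ.ne'
  set N := Γ.evolutionDefect ℂ z with hN
  -- The sum runs to `j = n`, so that the constant term `j = 0` is present even for `n = 0`; the
  -- overshoot at `j = n + 1` vanishes.
  have hn1 : (N ^ (n + 1)) a = 0 := by rw [pow_succ', Module.End.mul_apply, hn, map_zero]
  set q := newtonPoly (ℓ : ℂ) with hq
  let g : (E × Bool) ⊕ X → ℂ[X] := ∑ j ∈ Finset.range (n + 1), fun h => (N ^ j) a h • q j
  refine ⟨g, ?_, ?_⟩
  · have hev : ∀ (r : ℂ[X]) (b : (E × Bool) ⊕ X → ℂ),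
        z • Γ.evolution (fun h => b h • r) = fun h => b h • r + N b h • r := by
      intro r b
      have h1 := Γ.evolution_map (LinearMap.toSpanSingleton ℂ ℂ[X] r) b
      simp only [LinearMap.toSpanSingleton_apply] at h1
      rw [h1]
      funext h
      rw [← add_smul, hN, evolutionDefect_apply]
      simp [smul_smul]
    have hτ : (fun h => taylor (ℓ : ℂ) (g h)) =
        ∑ j ∈ Finset.range (n + 1), fun h => (N ^ j) a h • taylor (ℓ : ℂ) (q j) := by
      funext h
      simp [g, Finset.sum_apply]
    rw [mem_periodicAmp, hτ, map_sum, Finset.smul_sum]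
    simp only [hev]
    funext h
    simp only [g, Finset.sum_apply, ← Module.End.mul_apply, ← pow_succ']
    rw [Finset.sum_add_distrib, Finset.sum_range_succ (fun j => (N ^ (j + 1)) a h • _), hn1,
      Finset.sum_range_succ', Finset.sum_range_succ' (fun j => (N ^ j) a h • taylor (ℓ : ℂ) (q j))]
    simp only [hq]
    rw [newtonPoly_zero, taylor_one, map_one]
    have h3 : ∀ j, (N ^ (j + 1)) a h • newtonPoly (ℓ : ℂ) (j + 1) =
        (N ^ (j + 1)) a h • taylor (ℓ : ℂ) (newtonPoly (ℓ : ℂ) (j + 1)) +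
        (N ^ (j + 1)) a h • taylor (ℓ : ℂ) (newtonPoly (ℓ : ℂ) j) := fun j => by
      rw [← smul_add, ← newtonPoly_succ hℓ0]
    simp only [h3, Finset.sum_add_distrib, Pi.zero_apply, zero_smul, add_zero]
    abel
  · funext h
    rw [leavingAmp_apply]
    simp only [g, Finset.sum_apply]
    rw [Finset.sum_range_succ', eval_add, eval_finsetSum]
    simp [hq, newtonPoly_zero, newtonPoly_succ_eval_zero]

theorem rootSpace_eq_map {ℓ : ℝ} (hℓ : Γ.IsEquilateral ℓ) {k : ℂ} (hk : k ≠ 0) :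
    Γ.rootSpace k = (Γ.periodicAmp ℓ (Complex.exp (Complex.I * k * ℓ))).map
      (Γ.waveFun ℓ (Complex.I * k)) := by
  ext f
  rw [Submodule.mem_map]
  constructor
  · intro hf
    obtain ⟨g, rfl⟩ := Γ.exists_waveFun_of_mem_rootSpace ℓ hk hf
    exact ⟨g, (Γ.waveFun_mem_rootSpace_iff hℓ hk g).1 hf, rfl⟩
  · rintro ⟨g, hg, rfl⟩
    exact (Γ.waveFun_mem_rootSpace_iff hℓ hk g).2 hg

theorem map_periodicAmp_leavingAmp {ℓ : ℝ} (hℓ : 0 < ℓ) {z : ℂ} (hz : z ≠ 0) :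
    (Γ.periodicAmp ℓ z).map (leavingAmp E X) = Module.End.maxGenEigenspace Γ.evolution z⁻¹ := by
  ext a
  rw [Submodule.mem_map]
  constructor
  · rintro ⟨g, hg, rfl⟩
    exact Γ.eval_zero_mem_maxGenEigenspace hz hg
  · exact Γ.exists_mem_periodicAmp_eval_zero hℓ hz

/-- The root functions at `k ≠ 0` correspond to the generalized eigenvectors of the evolution for
the eigenvalue `e^{-ikℓ}`. -/
theorem nonempty_rootSpace_equiv {ℓ : ℝ} (hℓ : Γ.IsEquilateral ℓ) (hℓ0 : 0 < ℓ) {k : ℂ}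
    (hk : k ≠ 0) :
    Nonempty (Γ.rootSpace k ≃ₗ[ℂ] Module.End.maxGenEigenspace
      (Γ.evolution : Module.End ℂ ((E × Bool) ⊕ X → ℂ)) (Complex.exp (-(Complex.I * k * ℓ)))) := by
  set z := Complex.exp (Complex.I * k * ℓ) with hz
  rw [Complex.exp_neg, ← map_periodicAmp_leavingAmp Γ hℓ0 (Complex.exp_ne_zero _),
    rootSpace_eq_map Γ hℓ hk]
  have e₁ := Submodule.equivMapOfInjective (Γ.waveFun ℓ (Complex.I * k))
    (Γ.waveFun_injective ℓ (mul_ne_zero Complex.I_ne_zero hk)) (Γ.periodicAmp ℓ z)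
  have hinj : Function.Injective ((leavingAmp E X).domRestrict (Γ.periodicAmp ℓ z)) := by
    rw [injective_iff_map_eq_zero]
    intro g hg
    exact Subtype.ext (Γ.eq_zero_of_mem_periodicAmp_of_eval_zero hℓ0 g.2 hg)
  have e₂ := LinearEquiv.ofInjective _ hinj
  rw [LinearMap.range_domRestrict] at e₂
  exact ⟨e₁.symm.trans e₂⟩

theorem isResonance_iff {ℓ : ℝ} (hℓ : Γ.IsEquilateral ℓ) (hℓ0 : 0 < ℓ) {k : ℂ} (hk : k ≠ 0) :
    Γ.IsResonance k ↔ Module.End.HasEigenvalue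
      (Γ.evolution : Module.End ℂ ((E × Bool) ⊕ X → ℂ)) (Complex.exp (-(Complex.I * k * ℓ))) := by
  constructor
  · rintro ⟨f, ⟨⟨h1, h2⟩, h3⟩, hf0⟩
    have h1' : Γ.hamiltonian f = k ^ 2 • f := Module.End.mem_eigenspace_iff.1 h1
    have hf : f ∈ Γ.rootSpace k := by
      refine ⟨⟨Module.End.eigenspace_le_maxGenEigenspace h1, ?_⟩, fun x => ?_⟩
      · rw [SetLike.mem_coe, Submodule.mem_iInf]
        intro j
        have h4 : (Γ.hamiltonian ^ j) f = (k ^ 2) ^ j • f := by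
          induction j with
          | zero => simp
          | succ j ih => rw [pow_succ', Module.End.mul_apply, ih, map_smul, h1', smul_smul,
              ← pow_succ]
        rw [Submodule.mem_comap, h4]
        exact Submodule.smul_mem _ _ h2
      · obtain ⟨d, hd⟩ := h3 x
        exact ⟨C d, fun t => by rw [hd t, eval_C]⟩
    obtain ⟨e⟩ := Γ.nonempty_rootSpace_equiv hℓ hℓ0 hk
    have hne : Module.End.maxGenEigenspace (Γ.evolution : Module.End ℂ ((E × Bool) ⊕ X → ℂ))
        (Complex.exp (-(Complex.I * k * ℓ))) ≠ ⊥ := fun hbot => by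
      have h5 : ((e ⟨f, hf⟩ : Module.End.maxGenEigenspace
        (Γ.evolution : Module.End ℂ ((E × Bool) ⊕ X → ℂ)) _) : (E × Bool) ⊕ X → ℂ) = 0 :=
        (Submodule.mem_bot ℂ).1 (hbot ▸ (e ⟨f, hf⟩).2)
      have h6 : e ⟨f, hf⟩ = 0 := Subtype.ext h5
      rw [map_eq_zero_iff e e.injective] at h6
      exact hf0 (congrArg Subtype.val h6)
    exact Module.End.HasUnifEigenvalue.lt (by simp) hne
  · intro h
    obtain ⟨a, ha, ha0⟩ := h.exists_hasEigenvector
    have ha' : Γ.evolution a = Complex.exp (-(Complex.I * k * ℓ)) • a :=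
      Module.End.mem_eigenspace_iff.1 ha
    -- A true eigenvector gives constant amplitudes, hence pure exponentials on the edges.
    have hg : (fun h => C (a h)) ∈ Γ.periodicAmp ℓ (Complex.exp (Complex.I * k * ℓ)) := by
      rw [mem_periodicAmp]
      simp only [taylor_C]
      have h1 := Γ.evolution_map (Algebra.linearMap ℂ ℂ[X]) a
      simp only [Algebra.linearMap_apply, algebraMap_eq] at h1
      rw [h1, ha']
      funext h
      rw [Pi.smul_apply, Pi.smul_apply, smul_C, smul_smul, ← Complex.exp_add]
      simp
    have hr := (Γ.waveFun_mem_rootSpace_iff hℓ hk (fun h => C (a h))).2 hg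
    refine ⟨Γ.waveFun ℓ (Complex.I * k) fun h => C (a h), ⟨⟨?_, ?_⟩, fun x => ⟨a (Sum.inr x), fun t => ?_⟩⟩, fun h0 => ha0 ?_⟩
    · rw [SetLike.mem_coe, Module.End.mem_eigenspace_iff, hamiltonian_waveFun, ← map_neg,
        ← map_smul]
      congr 1
      funext h
      simp only [Pi.neg_apply, Pi.smul_apply, waveDerivative_apply, shiftedDerivative_apply,
        derivative_C, zero_add, smul_C]
      rw [sq_eq_neg_I_mul k, ← C_neg]
      simp [mul_assoc]
    · have := Submodule.mem_iInf _ |>.1 hr.1.2 0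
      simpa using this
    · rw [waveFun_inr, expPoly_apply, eval_C]
    · have h1 := (map_eq_zero_iff _
        (Γ.waveFun_injective ℓ (mul_ne_zero Complex.I_ne_zero hk))).1 h0
      funext h
      exact C_eq_zero.1 (congrFun h1 h)

end MetricGraph

/-! ### Balanced vertices and the rank of the third power of the evolution. -/

namespace MetricGraph

variable {V E X : Type*}

/-- The reversal of the directed internal edges. -/
def reversal (E : Type*) : (E × Bool → ℂ) →ₗ[ℂ] (E × Bool → ℂ) :=
  LinearMap.funLeft ℂ ℂ fun h => (h.1, !h.2)

@[simp] theorem reversal_apply (u : E × Bool → ℂ) (h : E × Bool) :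
    reversal E u h = u (h.1, !h.2) := rfl

theorem reversal_reversal (u : E × Bool → ℂ) : reversal E (reversal E u) = u := by
  funext h
  simp

/-- Extension of amplitudes by zero to the halflines. -/
def extendZero (E X : Type*) : (E × Bool → ℂ) →ₗ[ℂ] ((E × Bool) ⊕ X → ℂ) where
  toFun u := Sum.elim u fun _ => 0
  map_add' a b := by
    funext h
    rcases h with h | x <;> simp
  map_smul' r a := by
    funext h
    rcases h with h | x <;> simp

/-- Restriction of amplitudes to the internal edges. -/
def restrictInternal (E X : Type*) : ((E × Bool) ⊕ X → ℂ) →ₗ[ℂ] (E × Bool → ℂ) :=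
  LinearMap.funLeft ℂ ℂ Sum.inl

theorem incoming_eq_comp : (incoming : ((E × Bool) ⊕ X → ℂ) →ₗ[ℂ] _) =
    extendZero E X ∘ₗ reversal E ∘ₗ restrictInternal E X := by
  refine LinearMap.ext fun a => funext fun h => ?_
  rcases h with h | x <;> rfl

variable [Fintype E] (Γ : MetricGraph V E X)

open scoped Classical in
/-- The ends of internal edges at the vertex `v`. -/
def internalEndsAt (v : V) : Finset (E × Bool) := {h | Γ.endVertex (Sum.inl h) = v}

@[simp] theorem mem_internalEndsAt {v : V} {h : E × Bool} :
    h ∈ Γ.internalEndsAt v ↔ Γ.endVertex (Sum.inl h) = v := by simp [internalEndsAt]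

open scoped Classical in
/-- Averaging over the internal edge ends at each of the vertices in `Q`. -/
def averaging (Q : Set V) : (E × Bool → ℂ) →ₗ[ℂ] (E × Bool → ℂ) where
  toFun u h := if Γ.endVertex (Sum.inl h) ∈ Q then
    ((Γ.internalEndsAt (Γ.endVertex (Sum.inl h))).card : ℂ)⁻¹ *
      ∑ h' ∈ Γ.internalEndsAt (Γ.endVertex (Sum.inl h)), u h' else 0
  map_add' a b := by
    funext h
    simp only [Pi.add_apply, Finset.sum_add_distrib]
    split_ifs <;> ring
  map_smul' r a := by
    funext h
    simp only [Pi.smul_apply, smul_eq_mul, RingHom.id_apply, ← Finset.mul_sum]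
    split_ifs <;> ring

theorem averaging_apply_of_mem {Q : Set V} (u : E × Bool → ℂ) {h : E × Bool}
    (hh : Γ.endVertex (Sum.inl h) ∈ Q) :
    Γ.averaging Q u h = ((Γ.internalEndsAt (Γ.endVertex (Sum.inl h))).card : ℂ)⁻¹ *
      ∑ h' ∈ Γ.internalEndsAt (Γ.endVertex (Sum.inl h)), u h' := if_pos hh

theorem averaging_apply_of_notMem {Q : Set V} (u : E × Bool → ℂ) {h : E × Bool}
    (hh : Γ.endVertex (Sum.inl h) ∉ Q) : Γ.averaging Q u h = 0 := if_neg hh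

theorem card_internalEndsAt_ne_zero (h : E × Bool) :
    ((Γ.internalEndsAt (Γ.endVertex (Sum.inl h))).card : ℂ) ≠ 0 :=
  Nat.cast_ne_zero.2 (Finset.card_ne_zero_of_mem (Γ.mem_internalEndsAt.2 rfl))

/-- Averaging does not change functions of the initial vertex that are supported in `Q`. -/
theorem averaging_comp_endVertex {Q : Set V} {φ : V → ℂ} (hφ : ∀ v, v ∉ Q → φ v = 0) :
    Γ.averaging Q (fun h => φ (Γ.endVertex (Sum.inl h))) =
      fun h => φ (Γ.endVertex (Sum.inl h)) := by
  funext h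
  by_cases hh : Γ.endVertex (Sum.inl h) ∈ Q
  · rw [averaging_apply_of_mem Γ _ hh, Finset.sum_congr rfl fun h' hh' => by
      rw [Γ.mem_internalEndsAt.1 hh'], Finset.sum_const, nsmul_eq_mul,
      inv_mul_cancel_left₀ (Γ.card_internalEndsAt_ne_zero h)]
  · rw [averaging_apply_of_notMem Γ _ hh, hφ _ hh]

theorem sum_internalEndsAt_averaging {Q : Set V} {v : V} (hv : v ∈ Q) (u : E × Bool → ℂ) :
    ∑ h ∈ Γ.internalEndsAt v, Γ.averaging Q u h = ∑ h ∈ Γ.internalEndsAt v, u h := by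
  have h1 : ∀ h ∈ Γ.internalEndsAt v, Γ.averaging Q u h =
      ((Γ.internalEndsAt v).card : ℂ)⁻¹ * ∑ h' ∈ Γ.internalEndsAt v, u h' := fun h hh => by
    have hh' := Γ.mem_internalEndsAt.1 hh
    rw [averaging_apply_of_mem Γ u (hh'.symm ▸ hv), hh']
  rw [Finset.sum_congr rfl h1, Finset.sum_const, nsmul_eq_mul]
  by_cases hc : (Γ.internalEndsAt v).card = 0
  · simp [Finset.card_eq_zero.1 hc]
  · rw [mul_inv_cancel_left₀ (Nat.cast_ne_zero.2 hc)]

variable [Fintype X]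

theorem sum_endsAt {M : Type*} [AddCommMonoid M] (v : V) (b : (E × Bool) ⊕ X → M)
    (hb : ∀ x, b (Sum.inr x) = 0) :
    ∑ h ∈ Γ.endsAt v, b h = ∑ h ∈ Γ.internalEndsAt v, b (Sum.inl h) := by
  classical
  rw [endsAt, internalEndsAt, Finset.sum_filter, Finset.sum_filter, Fintype.sum_sum_type]
  simp [hb]

theorem card_endsAt_of_isBalanced {v : V} (hv : Γ.IsBalanced v) :
    (Γ.endsAt v).card = 2 * (Γ.internalEndsAt v).card := by
  classical
  have h1 : (Γ.endsAt v).card = (Γ.internalEndsAt v).card +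
      (Finset.univ.filter fun x => Γ.root x = v).card := by
    simp only [endsAt, internalEndsAt, Finset.card_filter, Fintype.sum_sum_type]
    rfl
  have h2 : (Γ.internalEndsAt v).card = (Finset.univ.filter fun x => Γ.root x = v).card := by
    have h3 := hv
    rw [IsBalanced, Nat.card_eq_fintype_card, Nat.card_eq_fintype_card, Fintype.card_subtype,
      Fintype.card_subtype] at h3
    rw [← h3, internalEndsAt]
  rw [h1, ← h2]
  ring

/-- The scattering at the vertices, restricted to the internal edges. -/
def internalScattering : (E × Bool → ℂ) →ₗ[ℂ] (E × Bool → ℂ) :=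
  restrictInternal E X ∘ₗ Γ.vertexScattering ∘ₗ extendZero E X

theorem internalScattering_apply (u : E × Bool → ℂ) (h : E × Bool) :
    Γ.internalScattering u h = 2 / ((Γ.endsAt (Γ.endVertex (Sum.inl h))).card : ℂ) *
      ∑ h' ∈ Γ.internalEndsAt (Γ.endVertex (Sum.inl h)), u h' - u h := by
  have h1 := Γ.sum_endsAt (Γ.endVertex (Sum.inl h)) (extendZero E X u) fun _ => rfl
  have h2 : Γ.internalScattering u h = Γ.vertexScattering (extendZero E X u) (Sum.inl h) := rfl
  rw [h2, vertexScattering_apply, h1]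
  rfl

theorem internalScattering_apply_of_isBalanced (u : E × Bool → ℂ) (h : E × Bool)
    (hv : Γ.IsBalanced (Γ.endVertex (Sum.inl h))) :
    Γ.internalScattering u h = ((Γ.internalEndsAt (Γ.endVertex (Sum.inl h))).card : ℂ)⁻¹ *
      ∑ h' ∈ Γ.internalEndsAt (Γ.endVertex (Sum.inl h)), u h' - u h := by
  rw [internalScattering_apply, card_endsAt_of_isBalanced Γ hv]
  have := Γ.card_internalEndsAt_ne_zero h
  push_cast
  field_simp

/-- At a balanced vertex scattering is the mean minus the identity, which kills functions constant
on the internal ends there. -/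
theorem internalScattering_averaging {Q : Set V} (hQ : ∀ v ∈ Q, Γ.IsBalanced v)
    (u : E × Bool → ℂ) : Γ.internalScattering (Γ.averaging Q u) = 0 := by
  funext h
  by_cases hh : Γ.endVertex (Sum.inl h) ∈ Q
  · rw [internalScattering_apply_of_isBalanced Γ _ _ (hQ _ hh), sum_internalEndsAt_averaging Γ hh,
      averaging_apply_of_mem Γ u hh, sub_self]
    rfl
  · have h1 : ∀ h' ∈ Γ.internalEndsAt (Γ.endVertex (Sum.inl h)), Γ.averaging Q u h' = 0 :=
      fun h' hh' => averaging_apply_of_notMem Γ u (by rwa [Γ.mem_internalEndsAt.1 hh'])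
    rw [internalScattering_apply, Finset.sum_eq_zero h1, averaging_apply_of_notMem Γ u hh]
    simp

/-- For the same reason the scattered amplitudes have mean zero at a balanced vertex. -/
theorem averaging_internalScattering {Q : Set V} (hQ : ∀ v ∈ Q, Γ.IsBalanced v)
    (u : E × Bool → ℂ) : Γ.averaging Q (Γ.internalScattering u) = 0 := by
  funext h
  by_cases hh : Γ.endVertex (Sum.inl h) ∈ Q
  · have h1 : ∀ h' ∈ Γ.internalEndsAt (Γ.endVertex (Sum.inl h)),
        Γ.internalScattering u h' = Γ.averaging Q u h' - u h' := fun h' hh' => by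
      have h2 := Γ.mem_internalEndsAt.1 hh'
      rw [internalScattering_apply_of_isBalanced Γ _ _ (hQ _ (h2.symm ▸ hh)),
        averaging_apply_of_mem Γ u (h2.symm ▸ hh)]
    rw [averaging_apply_of_mem Γ _ hh, Finset.sum_congr rfl h1, Finset.sum_sub_distrib,
      sum_internalEndsAt_averaging Γ hh, sub_self, mul_zero]
    rfl
  · rw [averaging_apply_of_notMem Γ _ hh]
    rfl

/-- The rank of the third power of the evolution is bounded in terms of the kernel of the reversal
compressed to the complement of the averages at balanced vertices. -/
theorem finrank_range_evolution_pow_three {Q : Set V} (hQ : ∀ v ∈ Q, Γ.IsBalanced v) :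
    Module.finrank ℂ (LinearMap.range
        ((Γ.evolution : Module.End ℂ ((E × Bool) ⊕ X → ℂ)) ^ 3)) +
      Module.finrank ℂ (LinearMap.ker ((LinearMap.id - Γ.averaging Q) ∘ₗ reversal E ∘ₗ
        (LinearMap.id - Γ.averaging Q))) ≤ 2 * Fintype.card E := by
  set K := (LinearMap.id - Γ.averaging Q) ∘ₗ reversal E ∘ₗ (LinearMap.id - Γ.averaging Q) with hK
  set A := Γ.vertexScattering ∘ₗ extendZero E X ∘ₗ reversal E with hA
  set B := reversal E ∘ₗ restrictInternal E X with hB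
  -- The third power is the first in which a reversal stands between two internal scatterings, so
  -- the averages can be removed on both sides of it.
  have h1 : (Γ.evolution : Module.End ℂ ((E × Bool) ⊕ X → ℂ)) ^ 3 =
      (A ∘ₗ Γ.internalScattering) ∘ₗ K ∘ₗ (Γ.internalScattering ∘ₗ B) := by
    refine LinearMap.ext fun a => ?_
    have h2 : ∀ b : (E × Bool) ⊕ X → ℂ, Γ.evolution b = A (restrictInternal E X b) := fun b => by
      rw [evolution_apply, incoming_eq_comp]
      rfl
    have h3 : ∀ u, restrictInternal E X (A u) = Γ.internalScattering (reversal E u) := fun u => rfl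
    simp only [pow_succ, pow_zero, one_mul, Module.End.mul_apply, h2, h3, hK, hB,
      LinearMap.comp_apply, LinearMap.sub_apply, LinearMap.id_apply, map_sub,
      internalScattering_averaging Γ hQ, averaging_internalScattering Γ hQ, sub_zero, map_zero]
  have h4 : Module.finrank ℂ (LinearMap.range
      ((Γ.evolution : Module.End ℂ ((E × Bool) ⊕ X → ℂ)) ^ 3)) ≤
      Module.finrank ℂ (LinearMap.range K) := by
    rw [h1, LinearMap.range_comp]
    refine (Submodule.finrank_map_le _ _).trans ?_
    exact Submodule.finrank_mono (LinearMap.range_comp_le_range _ _)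
  have h5 := LinearMap.finrank_range_add_finrank_ker K
  have h6 : Module.finrank ℂ (E × Bool → ℂ) = 2 * Fintype.card E := by
    rw [Module.finrank_fintype_fun_eq_card, Fintype.card_prod, Fintype.card_bool, mul_comm]
  omega

end MetricGraph

/-! ### The square and its adjacency kernel. -/

namespace MetricGraph

variable {V E X : Type*} (Γ : MetricGraph V E X)

theorem joins_of_endVertex {h : E × Bool} {v w : V} (h1 : Γ.endVertex (Sum.inl h) = v)
    (h2 : Γ.endVertex (Sum.inl (h.1, !h.2)) = w) : Γ.Joins h.1 v w := by
  rcases h with ⟨e, _ | _⟩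
  · exact Or.inl ⟨h1, h2⟩
  · exact Or.inr ⟨h2, h1⟩

theorem exists_end_of_joins {e : E} {v w : V} (h : Γ.Joins e v w) :
    ∃ b, Γ.endVertex (Sum.inl (e, b)) = v ∧ Γ.endVertex (Sum.inl (e, !b)) = w := by
  rcases h with ⟨h1, h2⟩ | ⟨h1, h2⟩
  · exact ⟨false, h1, h2⟩
  · exact ⟨true, h2, h1⟩

theorem neighbors_comm {v w : V} : Γ.Neighbors v w ↔ Γ.Neighbors w v :=
  exists_congr fun _ => or_comm

theorem injective_vecCons_four {a b c d : V} (hab : a ≠ b) (hac : a ≠ c) (had : a ≠ d)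
    (hbc : b ≠ c) (hbd : b ≠ d) (hcd : c ≠ d) : Function.Injective ![a, b, c, d] := by
  intro i j hij
  fin_cases i <;> fin_cases j <;> simp_all

variable [Fintype E]

open scoped Classical in
theorem sum_opposite_of_not_neighbors {v w : V} (hvw : ¬ Γ.Neighbors v w) (c : ℂ) :
    ∑ h ∈ Γ.internalEndsAt v,
      (if Γ.endVertex (Sum.inl (h.1, !h.2)) = w then c else 0) = 0 := by
  refine Finset.sum_eq_zero fun h hh => if_neg fun h2 => hvw ?_
  exact ⟨h.1, Γ.joins_of_endVertex (Γ.mem_internalEndsAt.1 hh) h2⟩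

open scoped Classical in
-- The sum counts the edges from `v` to `w`, an entry of the adjacency matrix; simplicity makes it
-- equal to one.
theorem sum_opposite_of_neighbors {v w : V} (hne : v ≠ w) (hvw : Γ.Neighbors v w)
    (huniq : ∀ e e', Γ.Joins e v w → Γ.Joins e' v w → e = e') (c : ℂ) :
    ∑ h ∈ Γ.internalEndsAt v,
      (if Γ.endVertex (Sum.inl (h.1, !h.2)) = w then c else 0) = c := by
  obtain ⟨e, he⟩ := hvw
  obtain ⟨b, hb1, hb2⟩ := Γ.exists_end_of_joins he
  rw [Finset.sum_eq_single (e, b), if_pos hb2]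
  · rintro ⟨e', b'⟩ hh hneq
    refine if_neg fun h2 => hneq ?_
    have h1 := Γ.mem_internalEndsAt.1 hh
    obtain rfl : e' = e := huniq _ _ (Γ.joins_of_endVertex h1 h2) he
    by_cases hbb : b' = b
    · rw [hbb]
    · obtain rfl : b' = !b := by cases b <;> cases b' <;> simp_all
      exact absurd (h1.symm.trans hb2) hne
  · intro hn
    exact absurd (Γ.mem_internalEndsAt.2 hb1) hn

open scoped Classical in
/-- The functions of the initial vertex supported at the vertices `q j`. -/
def vertexAmp (q : Fin 4 → V) : (Fin 4 → ℂ) →ₗ[ℂ] (E × Bool → ℂ) where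
  toFun a h := ∑ j, if Γ.endVertex (Sum.inl h) = q j then a j else 0
  map_add' a b := by
    funext h
    simp only [Pi.add_apply, ← Finset.sum_add_distrib]
    refine Finset.sum_congr rfl fun j _ => ?_
    split_ifs <;> simp
  map_smul' r a := by
    funext h
    simp only [Pi.smul_apply, smul_eq_mul, RingHom.id_apply, Finset.mul_sum, mul_ite, mul_zero]

/-- The vectors `(b₀, b₁, -b₀, -b₁)`, the kernel of the adjacency matrix of a square. -/
def squareKernel : (Fin 2 → ℂ) →ₗ[ℂ] (Fin 4 → ℂ) where
  toFun b := ![b 0, b 1, -b 0, -b 1]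
  map_add' a b := by
    funext i
    fin_cases i <;> simp <;> ring
  map_smul' r a := by
    funext i
    fin_cases i <;> simp

open scoped Classical in
theorem sum_internalEndsAt_reversal_vertexAmp (q : Fin 4 → V) (a : Fin 4 → ℂ) (v : V) :
    ∑ h ∈ Γ.internalEndsAt v, reversal E (Γ.vertexAmp q a) h =
      ∑ j, ∑ h ∈ Γ.internalEndsAt v,
        if Γ.endVertex (Sum.inl (h.1, !h.2)) = q j then a j else 0 := by
  rw [Finset.sum_comm]
  rfl

/-- A square of vertices without diagonals gives a six-dimensional kernel of the compressed
reversal. -/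
theorem six_le_finrank_ker {v₁ v₂ v₃ v₄ : V} (h13 : v₁ ≠ v₃) (h24 : v₂ ≠ v₄)
    (hloop : ∀ v ∈ ({v₁, v₂, v₃, v₄} : Set V), ¬ Γ.Neighbors v v)
    (hsimple : ∀ v ∈ ({v₁, v₂, v₃, v₄} : Set V), ∀ w ∈ ({v₁, v₂, v₃, v₄} : Set V),
      ∀ e e' : E, Γ.Joins e v w → Γ.Joins e' v w → e = e')
    (h12 : Γ.Neighbors v₁ v₂) (h23 : Γ.Neighbors v₂ v₃)
    (h34 : Γ.Neighbors v₃ v₄) (h41 : Γ.Neighbors v₄ v₁)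
    (hd13 : ¬ Γ.Neighbors v₁ v₃) (hd24 : ¬ Γ.Neighbors v₂ v₄) :
    6 ≤ Module.finrank ℂ (LinearMap.ker
      ((LinearMap.id - Γ.averaging {v₁, v₂, v₃, v₄}) ∘ₗ reversal E ∘ₗ
        (LinearMap.id - Γ.averaging {v₁, v₂, v₃, v₄}))) := by
  classical
  set Q : Set V := {v₁, v₂, v₃, v₄} with hQ
  have m1 : v₁ ∈ Q := by simp [hQ]
  have m2 : v₂ ∈ Q := by simp [hQ]
  have m3 : v₃ ∈ Q := by simp [hQ]
  have m4 : v₄ ∈ Q := by simp [hQ]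
  have hne : ∀ v ∈ Q, ∀ w, Γ.Neighbors v w → v ≠ w := fun v hv w hvw h =>
    hloop v hv (by rwa [← h] at hvw)
  set q : Fin 4 → V := ![v₁, v₂, v₃, v₄] with hq
  have hqQ : ∀ j, q j ∈ Q := fun j => by fin_cases j <;> simp [hq, hQ]
  have h21 := Γ.neighbors_comm.1 h12
  have h32 := Γ.neighbors_comm.1 h23
  have h43 := Γ.neighbors_comm.1 h34
  have h14 := Γ.neighbors_comm.1 h41
  have hd31 := fun h => hd13 (Γ.neighbors_comm.1 h)
  have hd42 := fun h => hd24 (Γ.neighbors_comm.1 h)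
  have hqinj : Function.Injective q :=
    injective_vecCons_four (hne _ m1 _ h12) h13 (hne _ m1 _ h14) (hne _ m2 _ h23) h24
      (hne _ m3 _ h34)
  have hend : ∀ j, ∃ h : E × Bool, Γ.endVertex (Sum.inl h) = q j := by
    have aux : ∀ v w, Γ.Neighbors v w → ∃ h : E × Bool, Γ.endVertex (Sum.inl h) = v := by
      rintro v w ⟨e, he⟩
      obtain ⟨b, hb, -⟩ := Γ.exists_end_of_joins he
      exact ⟨(e, b), hb⟩
    intro j
    fin_cases j
    · exact aux _ _ h12
    · exact aux _ _ h23
    · exact aux _ _ h34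
    · exact aux _ _ h41
  have havg : ∀ a, Γ.averaging Q (Γ.vertexAmp q a) = Γ.vertexAmp q a := fun a =>
    Γ.averaging_comp_endVertex (φ := fun v => ∑ j, if v = q j then a j else 0) fun v hv =>
      Finset.sum_eq_zero fun j _ => if_neg fun h : v = q j => hv (h.symm ▸ hqQ j)
  have hinj : ∀ a, Γ.vertexAmp q a = 0 → a = 0 := by
    intro a ha
    funext j
    obtain ⟨h, hh⟩ := hend j
    have h1 : (∑ i, if Γ.endVertex (Sum.inl h) = q i then a i else 0) = 0 := congrFun ha h
    rw [hh, Finset.sum_eq_single j] at h1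
    · simpa using h1
    · intro i _ hi
      exact if_neg fun h2 => hi (hqinj h2).symm
    · simp
  have hrev : ∀ b, Γ.averaging Q (reversal E (Γ.vertexAmp q (squareKernel b))) = 0 := by
    intro b
    have nb : ∀ v ∈ Q, ∀ w ∈ Q, Γ.Neighbors v w → ∀ c : ℂ, ∑ h ∈ Γ.internalEndsAt v,
        (if Γ.endVertex (Sum.inl (h.1, !h.2)) = w then c else 0) = c := fun v hv w hw hvw c =>
      Γ.sum_opposite_of_neighbors (hne v hv w hvw) hvw (hsimple v hv w hw) c
    -- The sum at `v` is the adjacency matrix of the square applied to `(b₀, b₁, -b₀, -b₁)`: the two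
    -- neighbors of each corner carry opposite values.
    have key : ∀ v ∈ Q, ∑ h ∈ Γ.internalEndsAt v,
        reversal E (Γ.vertexAmp q (squareKernel b)) h = 0 := by
      intro v hv
      rw [sum_internalEndsAt_reversal_vertexAmp, Fin.sum_univ_four]
      change ∑ h ∈ Γ.internalEndsAt v,
          (if Γ.endVertex (Sum.inl (h.1, !h.2)) = v₁ then b 0 else 0) +
        ∑ h ∈ Γ.internalEndsAt v,
          (if Γ.endVertex (Sum.inl (h.1, !h.2)) = v₂ then b 1 else 0) +
        ∑ h ∈ Γ.internalEndsAt v,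
          (if Γ.endVertex (Sum.inl (h.1, !h.2)) = v₃ then -b 0 else 0) +
        ∑ h ∈ Γ.internalEndsAt v,
          (if Γ.endVertex (Sum.inl (h.1, !h.2)) = v₄ then -b 1 else 0) = 0
      have hv' := hv
      rw [hQ] at hv'
      simp only [Set.mem_insert_iff, Set.mem_singleton_iff] at hv'
      rcases hv' with rfl | rfl | rfl | rfl
      · rw [Γ.sum_opposite_of_not_neighbors (hloop _ m1), nb _ m1 _ m2 h12,
          Γ.sum_opposite_of_not_neighbors hd13, nb _ m1 _ m4 h14]
        ring
      · rw [nb _ m2 _ m1 h21, Γ.sum_opposite_of_not_neighbors (hloop _ m2),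
          nb _ m2 _ m3 h23, Γ.sum_opposite_of_not_neighbors hd24]
        ring
      · rw [Γ.sum_opposite_of_not_neighbors hd31, nb _ m3 _ m2 h32,
          Γ.sum_opposite_of_not_neighbors (hloop _ m3), nb _ m3 _ m4 h34]
        ring
      · rw [nb _ m4 _ m1 h41, Γ.sum_opposite_of_not_neighbors hd42, nb _ m4 _ m3 h43,
          Γ.sum_opposite_of_not_neighbors (hloop _ m4)]
        ring
    funext h
    by_cases hh : Γ.endVertex (Sum.inl h) ∈ Q
    · rw [averaging_apply_of_mem Γ _ hh, key _ hh, mul_zero]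
      rfl
    · rw [averaging_apply_of_notMem Γ _ hh]
      rfl
  -- The four dimensions come from functions fixed by the averaging, the other two from reversals
  -- that the averaging kills.
  let Θ : ((Fin 4 → ℂ) × (Fin 2 → ℂ)) →ₗ[ℂ] (E × Bool → ℂ) :=
    (Γ.vertexAmp q).coprod (reversal E ∘ₗ Γ.vertexAmp q ∘ₗ squareKernel)
  have hΘ : ∀ a b, Θ (a, b) =
      Γ.vertexAmp q a + reversal E (Γ.vertexAmp q (squareKernel b)) := fun a b => by
    simp [Θ]
  have hker : ∀ x, Θ x ∈ LinearMap.ker ((LinearMap.id - Γ.averaging Q) ∘ₗ reversal E ∘ₗ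
      (LinearMap.id - Γ.averaging Q)) := by
    rintro ⟨a, b⟩
    rw [hΘ, LinearMap.mem_ker]
    simp only [LinearMap.comp_apply, LinearMap.sub_apply, LinearMap.id_apply, map_add, havg, hrev,
      map_sub, reversal_reversal]
    simp
  have hΘinj : Function.Injective Θ := by
    rw [injective_iff_map_eq_zero]
    rintro ⟨a, b⟩ h
    rw [hΘ] at h
    -- Averaging fixes the first summand and kills the second, so each of them vanishes separately.
    have h1 := congrArg (Γ.averaging Q) h
    rw [map_add, havg, hrev, add_zero, map_zero] at h1
    rw [h1, zero_add] at h
    have h2 := congrArg (reversal E) h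
    rw [reversal_reversal, map_zero] at h2
    have h3 := hinj _ h2
    have h4 : b = 0 := by
      funext i
      fin_cases i
      · exact congrFun h3 0
      · exact congrFun h3 1
    rw [hinj a h1, h4]
    rfl
  have h6 := LinearMap.finrank_le_finrank_of_injective
    (f := Θ.codRestrict _ hker) fun x y hxy => hΘinj (congrArg Subtype.val hxy)
  simpa using h6

end MetricGraph

/-! ### Counting the points of an arithmetic progression in a disc. -/

section PhaseCounting

theorem card_Icc_neg_floor_le (y : ℝ) (hy : 0 ≤ y) :
    ((Finset.Icc (-⌊y⌋) ⌊y⌋).card : ℝ) ≤ 2 * y + 1 := by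
  have h0 : 0 ≤ ⌊y⌋ := Int.floor_nonneg.2 hy
  have h1 : ((Finset.Icc (-⌊y⌋) ⌊y⌋).card : ℤ) = 2 * ⌊y⌋ + 1 := by
    rw [Int.card_Icc, Int.toNat_of_nonneg (by omega)]
    ring
  have h2 : ((Finset.Icc (-⌊y⌋) ⌊y⌋).card : ℝ) = 2 * ⌊y⌋ + 1 := by exact_mod_cast h1
  rw [h2]
  linarith [Int.floor_le y]

/-- Negative `y` must be allowed: it occurs below when the radius is smaller than the modulus of the
base point. -/
theorem le_card_Icc_neg_floor (y : ℝ) :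
    2 * y - 1 ≤ ((Finset.Icc (-⌊y⌋) ⌊y⌋).card : ℝ) := by
  have h1 : 2 * ⌊y⌋ + 1 ≤ ((Finset.Icc (-⌊y⌋) ⌊y⌋).card : ℤ) := by
    rw [Int.card_Icc]
    refine le_trans ?_ (Int.self_le_toNat _)
    omega
  have h2 : (2 * ⌊y⌋ + 1 : ℝ) ≤ ((Finset.Icc (-⌊y⌋) ⌊y⌋).card : ℝ) := by exact_mod_cast h1
  linarith [Int.lt_floor_add_one y]

/-- The solutions `k` of `e^{-ikℓ} = μ` in the disc of radius `R`. -/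
def phaseSolutions (ℓ : ℝ) (μ : ℂ) (R : ℝ) : Set ℂ :=
  {k | Complex.exp (-(Complex.I * k * ℓ)) = μ ∧ ‖k‖ ≤ R}

theorem exists_phaseSolutions_bound {ℓ : ℝ} (hℓ : 0 < ℓ) {μ : ℂ} (hμ : μ ≠ 0) :
    ∃ B : ℝ, ∀ R : ℝ, 0 ≤ R → (phaseSolutions ℓ μ R).Finite ∧
      |((phaseSolutions ℓ μ R).ncard : ℝ) - ℓ / Real.pi * R| ≤ B := by
  have hℓ' : (ℓ : ℂ) ≠ 0 := by exact_mod_cast hℓ.ne'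
  have hpi := Real.pi_pos
  -- `k₀` is the solution given by the principal logarithm; the others differ from it by integer
  -- multiples of `s`.
  set k₀ : ℂ := Complex.I * Complex.log μ / ℓ with hk₀
  set s : ℝ := 2 * Real.pi / ℓ with hs
  have hs0 : 0 < s := by positivity
  let κ : ℤ → ℂ := fun n => k₀ - n * (s : ℂ)
  have hκinj : Function.Injective κ := fun m n h => by
    have hs' : (s : ℂ) ≠ 0 := by exact_mod_cast hs0.ne'
    have h1 : (m : ℂ) * s = n * s := sub_right_inj.1 h
    exact_mod_cast mul_right_cancel₀ hs' h1
  have hκ : ∀ k, Complex.exp (-(Complex.I * k * ℓ)) = μ ↔ ∃ n, κ n = k := fun k => by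
    have h1 : μ = Complex.exp (Complex.log μ) := (Complex.exp_log hμ).symm
    conv_lhs => rw [h1]
    rw [Complex.exp_eq_exp_iff_exists_int]
    refine exists_congr fun n => ?_
    have hsc : (s : ℂ) = 2 * Real.pi / ℓ := by rw [hs]; push_cast; ring
    simp only [κ, hk₀, hsc]
    constructor
    · intro h
      field_simp
      linear_combination (-Complex.I) * h + (-(k * ℓ) - n * (2 * Real.pi)) * Complex.I_mul_I
    · intro h
      rw [← h]
      field_simp
      linear_combination (-Complex.log μ) * Complex.I_mul_I
  have himage : ∀ R, phaseSolutions ℓ μ R = κ '' {n | ‖κ n‖ ≤ R} := fun R => by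
    ext k
    simp only [phaseSolutions, Set.mem_ofPred_eq, hκ, Set.mem_image]
    constructor
    · rintro ⟨⟨n, rfl⟩, h⟩
      exact ⟨n, h, rfl⟩
    · rintro ⟨n, h, rfl⟩
      exact ⟨⟨n, rfl⟩, h⟩
  have hnorm : ∀ n : ℤ, ‖(n : ℂ) * (s : ℂ)‖ = |(n : ℝ)| * s := fun n => by
    rw [norm_mul, Complex.norm_intCast, Complex.norm_real, Real.norm_of_nonneg hs0.le]
  have hIcc : ∀ (y : ℝ) (n : ℤ), n ∈ Finset.Icc (-⌊y⌋) ⌊y⌋ ↔ |(n : ℝ)| ≤ y := fun y n => by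
    rw [Finset.mem_Icc, abs_le, neg_le, Int.le_floor, Int.le_floor]
    push_cast
    rw [neg_le]
  refine ⟨2 * ‖k₀‖ / s + 1, fun R hR => ?_⟩
  set y := (R + ‖k₀‖) / s with hy
  set y' := (R - ‖k₀‖) / s with hy'
  have hsub : {n | ‖κ n‖ ≤ R} ⊆ (Finset.Icc (-⌊y⌋) ⌊y⌋ : Finset ℤ) := fun n hn => by
    rw [Finset.mem_coe, hIcc, hy, le_div_iff₀ hs0, ← hnorm]
    have h1 : ‖(n : ℂ) * (s : ℂ)‖ ≤ ‖k₀‖ + ‖κ n‖ := by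
      have : (n : ℂ) * (s : ℂ) = k₀ - κ n := by simp [κ]
      rw [this]
      exact norm_sub_le _ _
    have h2 : ‖κ n‖ ≤ R := hn
    linarith
  have hsup : ((Finset.Icc (-⌊y'⌋) ⌊y'⌋ : Finset ℤ) : Set ℤ) ⊆ {n | ‖κ n‖ ≤ R} := fun n hn => by
    rw [Finset.mem_coe, hIcc, hy', le_div_iff₀ hs0, ← hnorm] at hn
    have h1 : ‖κ n‖ ≤ ‖k₀‖ + ‖(n : ℂ) * (s : ℂ)‖ := norm_sub_le _ _
    rw [Set.mem_ofPred_eq]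
    linarith
  have hfin : {n | ‖κ n‖ ≤ R}.Finite := (Finset.finite_toSet _).subset hsub
  rw [himage]
  refine ⟨hfin.image _, ?_⟩
  rw [Set.ncard_image_of_injective _ hκinj]
  have hu : (({n | ‖κ n‖ ≤ R}.ncard : ℕ) : ℝ) ≤ 2 * y + 1 := by
    refine le_trans ?_ (card_Icc_neg_floor_le y (by positivity))
    have := Set.ncard_le_ncard hsub (Finset.finite_toSet _)
    rw [Set.ncard_coe_finset] at this
    exact_mod_cast this
  have hl : 2 * y' - 1 ≤ (({n | ‖κ n‖ ≤ R}.ncard : ℕ) : ℝ) := by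
    refine le_trans (le_card_Icc_neg_floor y') ?_
    have := Set.ncard_le_ncard hsup hfin
    rw [Set.ncard_coe_finset] at this
    exact_mod_cast this
  have e : ℓ / Real.pi * R = 2 * R / s := by
    rw [hs]
    field_simp
  have e1 : 2 * y = 2 * R / s + 2 * ‖k₀‖ / s := by rw [hy]; ring
  have e2 : 2 * y' = 2 * R / s - 2 * ‖k₀‖ / s := by rw [hy']; ring
  rw [e, abs_le]
  constructor <;> linarith

end PhaseCounting

/-! ### Nonzero eigenvalues of the evolution and the effective size. -/

/-- The number of nonzero eigenvalues, with algebraic multiplicities, is at most the rank of any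
power. -/
theorem sum_rootMultiplicity_erase_zero_le {M : Type*} [AddCommGroup M] [Module ℂ M]
    [FiniteDimensional ℂ M] (S : Module.End ℂ M) (n : ℕ) :
    ∑ μ ∈ S.charpoly.roots.toFinset.erase 0, S.charpoly.rootMultiplicity μ ≤
      Module.finrank ℂ (LinearMap.range (S ^ n)) := by
  have h1 : ∑ μ ∈ S.charpoly.roots.toFinset, S.charpoly.rootMultiplicity μ =
      Module.finrank ℂ M := by
    simp only [← count_roots]
    rw [Multiset.toFinset_sum_count_eq, ← (IsAlgClosed.splits S.charpoly).natDegree_eq_card_roots,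
      LinearMap.charpoly_natDegree]
  have h2 : ∑ μ ∈ S.charpoly.roots.toFinset.erase 0, S.charpoly.rootMultiplicity μ +
      S.charpoly.rootMultiplicity 0 = Module.finrank ℂ M := by
    rw [← h1]
    by_cases h0 : (0 : ℂ) ∈ S.charpoly.roots.toFinset
    · exact Finset.sum_erase_add _ _ h0
    · rw [Finset.erase_eq_of_notMem h0]
      have h3 : S.charpoly.rootMultiplicity 0 = 0 := by
        rw [← count_roots, Multiset.count_eq_zero]
        simpa using h0
      rw [h3, add_zero]
  -- The kernel of any power lies in the generalized eigenspace for `0`.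
  have h4 : Module.finrank ℂ (LinearMap.ker (S ^ n)) ≤ S.charpoly.rootMultiplicity 0 := by
    rw [← LinearMap.finrank_maxGenEigenspace_eq]
    refine Submodule.finrank_mono fun x hx => ?_
    rw [Module.End.mem_maxGenEigenspace]
    exact ⟨n, by simpa using hx⟩
  have h5 := LinearMap.finrank_range_add_finrank_ker (S ^ n)
  omega

namespace MetricGraph

variable {V E X : Type*} [Fintype E] [Fintype X] (Γ : MetricGraph V E X)

/-- Half the length of an edge times the number of nonzero eigenvalues of the evolution, with
algebraic multiplicities, is the effective size of an equilateral graph. -/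
theorem isEffectiveSize_of_isEquilateral {ℓ : ℝ} (hℓ : Γ.IsEquilateral ℓ) (hℓ0 : 0 < ℓ) :
    Γ.IsEffectiveSize (((∑ μ ∈ (LinearMap.charpoly
      (Γ.evolution : Module.End ℂ ((E × Bool) ⊕ X → ℂ))).roots.toFinset.erase 0,
      (LinearMap.charpoly (Γ.evolution : Module.End ℂ ((E × Bool) ⊕ X → ℂ))).rootMultiplicity μ : ℕ)
        : ℝ) * ℓ / 2) := by
  set S : Module.End ℂ ((E × Bool) ⊕ X → ℂ) := Γ.evolution with hS
  set χ := LinearMap.charpoly S with hχ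
  set Λ := χ.roots.toFinset.erase 0 with hΛ
  let ε : ℂ → ℂ := fun k => Complex.exp (-(Complex.I * k * ℓ))
  have hχ0 : χ ≠ 0 := (LinearMap.charpoly_monic S).ne_zero
  have hres : ∀ k, k ≠ 0 → (Γ.IsResonance k ↔ ε k ∈ Λ) := fun k hk => by
    rw [Γ.isResonance_iff hℓ hℓ0 hk, Module.End.hasEigenvalue_iff_isRoot_charpoly, hΛ,
      Finset.mem_erase, Multiset.mem_toFinset, mem_roots hχ0]
    exact ⟨fun h => ⟨Complex.exp_ne_zero _, h⟩, fun h => h.2⟩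
  have hmult : ∀ k, k ≠ 0 → Γ.resonanceMultiplicity k = χ.rootMultiplicity (ε k) := fun k hk => by
    obtain ⟨e⟩ := Γ.nonempty_rootSpace_equiv hℓ hℓ0 hk
    rw [resonanceMultiplicity, if_neg hk, e.finrank_eq, LinearMap.finrank_maxGenEigenspace_eq]
  -- The bound is stated for every `μ`, with the idle value `0` outside `Λ`, so that it can be
  -- chosen as a function of `μ`.
  have hbound : ∀ μ, ∃ B : ℝ, μ ∈ Λ → ∀ R : ℝ, 0 ≤ R → (phaseSolutions ℓ μ R).Finite ∧
      |((phaseSolutions ℓ μ R).ncard : ℝ) - ℓ / Real.pi * R| ≤ B := fun μ => by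
    by_cases hμ : μ ∈ Λ
    · obtain ⟨B, hB⟩ := exists_phaseSolutions_bound hℓ0 (Finset.ne_of_mem_erase hμ)
      exact ⟨B, fun _ => hB⟩
    · exact ⟨0, fun h => absurd h hμ⟩
  choose B hB using hbound
  have hfin : ∀ R, (Γ.resonancesIn R).Finite := fun R => by
    rcases lt_or_ge R 0 with hR | hR
    · refine Set.finite_empty.subset fun k hk => ?_
      exact absurd (norm_nonneg k) (not_le.2 (lt_of_le_of_lt hk.2 hR))
    · refine ((Set.finite_singleton (0 : ℂ)).union
        (Λ.finite_toSet.biUnion fun μ hμ => (hB μ hμ R hR).1)).subset fun k hk => ?_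
      by_cases hk0 : k = 0
      · exact Or.inl hk0
      · exact Or.inr (Set.mem_biUnion ((hres k hk0).1 hk.1) ⟨rfl, hk.2⟩)
  refine ⟨hfin, fun k hk => ?_, ?_⟩
  · obtain ⟨e⟩ := Γ.nonempty_rootSpace_equiv hℓ hℓ0 hk
    exact Module.Finite.equiv e.symm
  · rw [Asymptotics.isBigO_iff]
    -- The point `k = 0` is counted separately by the first term; the `+ 1` pays for removing it
    -- from the progression of an eigenvalue (only `μ = 1` is affected).
    refine ⟨(Γ.resonanceMultiplicity 0 : ℝ) + ∑ μ ∈ Λ, χ.rootMultiplicity μ * (B μ + 1), ?_⟩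
    filter_upwards [Filter.eventually_ge_atTop (0 : ℝ)] with R hR
    rw [norm_one, mul_one, Real.norm_eq_abs]
    set F := (hfin R).toFinset with hF
    have hmemF : ∀ k, k ∈ F ↔ Γ.IsResonance k ∧ ‖k‖ ≤ R := fun k => by
      rw [hF, Set.Finite.mem_toFinset]
      rfl
    have hN : Γ.countingFunction R = ∑ k ∈ F, Γ.resonanceMultiplicity k :=
      finsum_mem_eq_finite_toFinset_sum _ (hfin R)
    set G := F.erase 0 with hG
    have hsum : ∑ k ∈ G, Γ.resonanceMultiplicity k =
        ∑ μ ∈ Λ, χ.rootMultiplicity μ * (G.filter fun k => ε k = μ).card := by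
      rw [← Finset.sum_fiberwise_of_maps_to (s := G) (t := Λ) (g := ε) fun k hk => by
        have hk' := Finset.mem_erase.1 hk
        exact (hres k hk'.1).1 ((hmemF k).1 hk'.2).1]
      refine Finset.sum_congr rfl fun μ _ => ?_
      rw [Finset.sum_congr rfl fun k hk => by
        have hk' := Finset.mem_filter.1 hk
        rw [hmult k (Finset.ne_of_mem_erase hk'.1), hk'.2], Finset.sum_const, smul_eq_mul, mul_comm]
    have hcard : ∀ μ ∈ Λ, |((G.filter fun k => ε k = μ).card : ℝ) - ℓ / Real.pi * R| ≤ B μ + 1 := by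
      intro μ hμ
      obtain ⟨hf, hb⟩ := hB μ hμ R hR
      have h1 : ((G.filter fun k => ε k = μ : Finset ℂ) : Set ℂ) = phaseSolutions ℓ μ R \ {0} := by
        ext k
        simp only [Finset.coe_filter, hG, Finset.mem_erase, hmemF, Set.mem_ofPred_eq, Set.mem_sdiff,
          Set.mem_singleton_iff, phaseSolutions]
        constructor
        · rintro ⟨⟨h0, -, h2⟩, h3⟩
          exact ⟨⟨h3, h2⟩, h0⟩
        · rintro ⟨⟨h3, h2⟩, h0⟩
          refine ⟨⟨h0, (hres k h0).2 ?_, h2⟩, h3⟩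
          have h4 : ε k = μ := h3
          rwa [h4]
      have h2 : (G.filter fun k => ε k = μ).card = (phaseSolutions ℓ μ R \ {0}).ncard := by
        rw [← h1, Set.ncard_coe_finset]
      have h3 : (phaseSolutions ℓ μ R \ {0}).ncard ≤ (phaseSolutions ℓ μ R).ncard :=
        Set.ncard_le_ncard Set.sdiff_subset hf
      have h4 : (phaseSolutions ℓ μ R).ncard ≤ (phaseSolutions ℓ μ R \ {0}).ncard + 1 := by
        have h5 := Set.ncard_le_ncard_sdiff_add_ncard (phaseSolutions ℓ μ R) {(0 : ℂ)}
        rwa [Set.ncard_singleton] at h5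
      rw [← h2] at h3 h4
      have h3' : ((G.filter fun k => ε k = μ).card : ℝ) ≤ (phaseSolutions ℓ μ R).ncard := by
        exact_mod_cast h3
      have h4' : ((phaseSolutions ℓ μ R).ncard : ℝ) ≤ (G.filter fun k => ε k = μ).card + 1 := by
        exact_mod_cast h4
      rw [abs_le] at hb ⊢
      constructor <;> linarith
    have hzero : |(Γ.countingFunction R : ℝ) - ((∑ k ∈ G, Γ.resonanceMultiplicity k : ℕ) : ℝ)| ≤
        Γ.resonanceMultiplicity 0 := by
      rw [hN]
      by_cases h0 : (0 : ℂ) ∈ F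
      · rw [← Finset.sum_erase_add F _ h0, Nat.cast_add, add_sub_cancel_left, Nat.abs_cast]
      · rw [hG, Finset.erase_eq_of_notMem h0, sub_self, abs_zero]
        exact Nat.cast_nonneg _
    have hmain : |((∑ k ∈ G, Γ.resonanceMultiplicity k : ℕ) : ℝ) -
        2 / Real.pi * (((∑ μ ∈ Λ, χ.rootMultiplicity μ : ℕ) : ℝ) * ℓ / 2) * R| ≤
        ∑ μ ∈ Λ, χ.rootMultiplicity μ * (B μ + 1) := by
      have e : ((∑ k ∈ G, Γ.resonanceMultiplicity k : ℕ) : ℝ) -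
          2 / Real.pi * (((∑ μ ∈ Λ, χ.rootMultiplicity μ : ℕ) : ℝ) * ℓ / 2) * R =
          ∑ μ ∈ Λ, (χ.rootMultiplicity μ : ℝ) *
            (((G.filter fun k => ε k = μ).card : ℝ) - ℓ / Real.pi * R) := by
        rw [hsum]
        push_cast
        simp only [mul_sub, Finset.sum_sub_distrib, ← Finset.sum_mul]
        ring
      rw [e]
      refine (Finset.abs_sum_le_sum_abs _ _).trans (Finset.sum_le_sum fun μ hμ => ?_)
      rw [abs_mul, Nat.abs_cast]
      exact mul_le_mul_of_nonneg_left (hcard μ hμ) (Nat.cast_nonneg _)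
    refine (abs_sub_le _ _ _).trans (add_le_add hzero hmain)

end MetricGraph

end

theorem mainTheorem2 {V E X : Type*} [Fintype E] [Fintype X] (Γ : MetricGraph V E X)
    (ℓ : ℝ) (hℓ : Γ.IsEquilateral ℓ)
    (v₁ v₂ v₃ v₄ : V) (h13 : v₁ ≠ v₃) (h24 : v₂ ≠ v₄)
    (hbal : ∀ v ∈ ({v₁, v₂, v₃, v₄} : Set V), Γ.IsBalanced v)
    -- no loops at the four vertices and no multiple edges between them
    (hloop : ∀ v ∈ ({v₁, v₂, v₃, v₄} : Set V), ¬ Γ.Neighbors v v)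
    (hsimple : ∀ v ∈ ({v₁, v₂, v₃, v₄} : Set V), ∀ w ∈ ({v₁, v₂, v₃, v₄} : Set V),
      ∀ e e' : E, Γ.Joins e v w → Γ.Joins e' v w → e = e')
    -- a square without diagonals
    (h12 : Γ.Neighbors v₁ v₂) (h23 : Γ.Neighbors v₂ v₃)
    (h34 : Γ.Neighbors v₃ v₄) (h41 : Γ.Neighbors v₄ v₁)
    (hd13 : ¬ Γ.Neighbors v₁ v₃) (hd24 : ¬ Γ.Neighbors v₂ v₄) :
    ∃ W : ℝ, Γ.IsEffectiveSize W ∧ W ≤ ((Fintype.card E : ℝ) - 3) * ℓ := by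
  -- Positivity of `ℓ` needs an internal edge; a side of the square supplies one.
  have hℓ0 : 0 < ℓ := by
    obtain ⟨e, -⟩ := h12
    rw [← hℓ e]
    exact Γ.length_pos e
  refine ⟨_, Γ.isEffectiveSize_of_isEquilateral hℓ hℓ0, ?_⟩
  have h1 := sum_rootMultiplicity_erase_zero_le
    (Γ.evolution : Module.End ℂ ((E × Bool) ⊕ X → ℂ)) 3
  have h2 := Γ.finrank_range_evolution_pow_three hbal
  have h3 := Γ.six_le_finrank_ker h13 h24 hloop hsimple h12 h23 h34 h41 hd13 hd24
  have h4 : ∑ μ ∈ (LinearMap.charpoly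
      (Γ.evolution : Module.End ℂ ((E × Bool) ⊕ X → ℂ))).roots.toFinset.erase 0,
      (LinearMap.charpoly (Γ.evolution : Module.End ℂ ((E × Bool) ⊕ X → ℂ))).rootMultiplicity μ + 6
      ≤ 2 * Fintype.card E := by omega
  have h5 : ((∑ μ ∈ (LinearMap.charpoly
      (Γ.evolution : Module.End ℂ ((E × Bool) ⊕ X → ℂ))).roots.toFinset.erase 0,
      (LinearMap.charpoly (Γ.evolution : Module.End ℂ ((E × Bool) ⊕ X → ℂ))).rootMultiplicity μ : ℕ)
        : ℝ) + 6 ≤ 2 * Fintype.card E := by exact_mod_cast h4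
  nlinarith
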